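/- Let $\zeta(s,w)=\sum_{n\ge 0}(n+w)^{-s}$ ($\operatorname{Re}s>1$, $\operatorname{Re}w>0$) be the Hurwitz zeta function, $s(n,k)$ the signed Stirling numbers of the first kind, given by $x(x-1)\cdots(x-n+1)=\sum_k s(n,k)x^k$, $H_n=\sum_{k=1}^n \frac1k$ the harmonic numbers ($H_0=0$), $\psi=\Gamma'/\Gamma$ the digamma function, and $\binom{y}{n}=\frac{1}{n!}y(y-1)\cdots(y-n+1)$. For integers $0\le j\le m$ define $$z_\ell(m,j)(x)=2\int_0^\infty \operatorname{Re}\left\{(\ell+iu)^{m-j}\,\zeta(2\ell+1-j,\ell+iu)\right\}\log\left(1+\frac{u^2}{(x-\ell)^2}\right)du$$ and $$Z_\ell(m,j)(x)=2\int_0^\infty \operatorname{Re}\left\{(\ell+\tfrac12+iu)^{m-j}\,\zeta(2\ell+2-j,\ell+\tfrac12+iu)\right\}\log\left(1+\frac{u^2}{(x-\ell-\frac12)^2}\right)du.$$ (a) For every integer $\ell\ge 1$ and every real $x>\ell$, the integrals $z_\ell(m,j)(x)$ with $0\le j\le m\le 2\ell-1$ converge absolutely, and $$\sum_{j=0}^{2\ell-1}(-1)^{j-1}\sum_{m=j}^{2\ell-1}\binom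 mj s(2\ell,m+1)\,z_\ell(m,j)(x)=-\frac{\pi}{\ell}\left(\log(x-\ell)+H_{2\ell-1}-\frac{d^{2\ell-1}}{dx^{2\ell-1}}\left\{\binom{x-1}{2\ell-1}\psi(x-\ell)\right\}\right).$$ (b) For every integer $\ell\ge 0$ and every real $x>\ell+\frac12$, the integrals $Z_\ell(m,j)(x)$ with $0\le j\le m\le 2\ell$ converge absolutely, and $$\sum_{j=0}^{2\ell}(-1)^{j}\sum_{m=j}^{2\ell}\binom mj s(2\ell+1,m+1)\,Z_\ell(m,j)(x)=-\frac{2\pi}{2\ell+1}\left(\log(x-\ell-\tfrac12)+H_{2\ell}-\frac{d^{2\ell}}{dx^{2\ell}}\left\{\binom{x-1}{2\ell}\psi(x-\ell)\right\}\right).$$ -/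

import Mathlib

namespace HurwitzLog

/-- The Hurwitz zeta function `ζ(s, w) = ∑_{n ≥ 0} (n + w)^{-s}` with complex parameter `w`
(principal branch of the power), in its domain of convergence `Re s > 1`, `Re w > 0`. -/
noncomputable def hurwitzZeta (s w : ℂ) : ℂ :=
  ∑' n : ℕ, 1 / ((n : ℂ) + w) ^ s

/-- The defining series converges absolutely for `Re s > 1`, `Re w > 0`. -/
theorem summable_hurwitzZeta {s w : ℂ} (hs : 1 < s.re) (hw : 0 < w.re) :
    Summable (fun n : ℕ => 1 / ((n : ℂ) + w) ^ s) := by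
  have h0 : Summable (fun n : ℕ =>
      Real.exp (Real.pi * |s.im|) * (1 / |(n : ℝ) + w.re| ^ s.re)) :=
    ((Real.summable_one_div_nat_add_rpow w.re s.re).2 hs).mul_left _
  refine Summable.of_norm_bounded h0 fun n => ?_
  have hn : (0 : ℝ) < n + w.re := by positivity
  have hre : ((n : ℂ) + w).re = n + w.re := by simp
  have hne : (n : ℂ) + w ≠ 0 := fun h => by
    rw [h] at hre
    simp at hre
    linarith
  rw [norm_div, norm_one, Complex.norm_cpow_of_ne_zero hne, one_div_div, div_eq_mul_one_div]
  have h1 : (n : ℂ).re + w.re = n + w.re := by simp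
  have h2 : |(n : ℝ) + w.re| ≤ ‖(n : ℂ) + w‖ := by
    rw [← hre]
    exact Complex.abs_re_le_norm _
  have h3 : Complex.arg ((n : ℂ) + w) * s.im ≤ Real.pi * |s.im| := by
    refine (le_abs_self _).trans ?_
    rw [abs_mul]
    exact mul_le_mul_of_nonneg_right (Complex.abs_arg_le_pi _) (abs_nonneg _)
  have h4 : 0 < |(n : ℝ) + w.re| := abs_pos.2 hn.ne'
  gcongr

/-- The (signed) Stirling numbers of the first kind,
`x (x - 1) ⋯ (x - n + 1) = ∑_k s(n, k) x^k`. -/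
def stirlingS (n k : ℕ) : ℤ :=
  (-1) ^ (n + k) * (Nat.stirlingFirst n k : ℤ)

/-- The generalized binomial coefficient `x (x - 1) ⋯ (x - n + 1) / n!`. -/
noncomputable def binom (x : ℝ) (n : ℕ) : ℝ :=
  (∏ i ∈ Finset.range n, (x - i)) / (n.factorial : ℝ)

/-- The digamma function `ψ = Γ' / Γ` of a real variable. -/
noncomputable def digamma (x : ℝ) : ℝ := logDeriv Real.Gamma x

/-- On the positive reals `digamma` agrees with the complex digamma function. -/
theorem ofReal_digamma {x : ℝ} (hx : 0 < x) :
    ((digamma x : ℝ) : ℂ) = Complex.digamma (x : ℂ) := by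
  have hd : DifferentiableAt ℝ Real.Gamma x := by
    refine Real.differentiableAt_Gamma fun m => ?_
    have : (0 : ℝ) ≤ m := Nat.cast_nonneg m
    intro h
    linarith
  have hc : DifferentiableAt ℂ Complex.Gamma (x : ℂ) := by
    refine Complex.differentiableAt_Gamma _ fun m h => ?_
    have h' : x = -(m : ℝ) := by exact_mod_cast h
    have : (0 : ℝ) ≤ m := Nat.cast_nonneg m
    linarith
  have h1 := hd.hasDerivAt.ofReal_comp
  have h2 := hc.hasDerivAt.comp_ofReal
  have h3 : (fun y : ℝ => Complex.Gamma (y : ℂ)) = fun y : ℝ => ((Real.Gamma y : ℝ) : ℂ) := by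
    funext y
    exact Complex.Gamma_ofReal y
  rw [h3] at h2
  have h4 := h1.unique h2
  rw [digamma, Complex.digamma_def, logDeriv_apply, logDeriv_apply, Complex.Gamma_ofReal, ← h4]
  push_cast
  rfl

/-- The real integrand `Re { (a + iu)^k ζ(s, a + iu) } log (1 + u² / c²)`. -/
noncomputable def integrand (a : ℝ) (k : ℕ) (s : ℂ) (c u : ℝ) : ℝ :=
  (((a : ℂ) + Complex.I * u) ^ k * hurwitzZeta s ((a : ℂ) + Complex.I * u)).re *
    Real.log (1 + u ^ 2 / c ^ 2)

/-- The integrand of `z_ℓ(m, j)(x)`, for `j ≤ m`. -/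
noncomputable def zIntegrand (ℓ m j : ℕ) (x u : ℝ) : ℝ :=
  integrand ℓ (m - j) (2 * (ℓ : ℂ) + 1 - (j : ℂ)) (x - ℓ) u

/-- `z_ℓ(m, j)(x)`, for `j ≤ m`. -/
noncomputable def z (ℓ m j : ℕ) (x : ℝ) : ℝ :=
  2 * ∫ u in Set.Ioi (0 : ℝ), zIntegrand ℓ m j x u

/-- The integrand of `Z_ℓ(m, j)(x)`, for `j ≤ m`. -/
noncomputable def ZIntegrand (ℓ m j : ℕ) (x u : ℝ) : ℝ :=
  integrand (ℓ + 1 / 2) (m - j) (2 * (ℓ : ℂ) + 2 - (j : ℂ)) (x - ℓ - 1 / 2) u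

/-- `Z_ℓ(m, j)(x)`, for `j ≤ m`. -/
noncomputable def Z (ℓ m j : ℕ) (x : ℝ) : ℝ :=
  2 * ∫ u in Set.Ioi (0 : ℝ), ZIntegrand ℓ m j x u

end HurwitzLog

/-! Write `M + 1` for the first index of the Stirling numbers, `κ(t) = t / (1 - e^{-t})`, and `c = x
- a` with `a` the abscissa of the vertical line. Both identities are one computation with a cosine
transform, evaluated in two ways.

The double sum of zeta values collapses: termwise in `n`, the sum over `j` is the binomial expansion
of `(w - (n + w))^m = (-n)^m`, and the sum over `m` is then a rising factorial. What remains is `∑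
(n+1)⋯(n+M) / (n+w)^{M+2}`, which by the negative binomial series is the Laplace transform of
`κ^{M+1} / (M+1)`. On `w = a + iu` its real part is therefore the cosine transform of `g(t) =
κ(t)^{M+1} e^{-at} / (M+1)` (`sum_hurwitzZeta_eq_risingSeries`, `re_risingSeries_vertical`).

Since `log (1 + u²/c²) = 2 ∫ (1 - cos ut) e^{-ct} dt/t`, Fubini and Fourier inversion turn the
integral against the logarithm into `2π ∫ (g(0) - g(t)) e^{-ct} dt/t`
(`integral_cosTransform_mul_log`). This is `2π/(M+1)` times `G_{M+1}(x) - log c`, where `G_N(x) = ∫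
(e^{-t} - κ^N e^{-xt}) dt/t`.

Independently, `G_1 = ψ` is Gauss' formula, and the Riccati equation of `κ` gives a recurrence in
`N`, by which the `M`-th derivative of `binom(x-1, M) ψ(x)` is `H_M + G_{M+1}(x)`
(`iteratedDeriv_binom_mul_digamma`). Shifting the argument of `ψ` by an integer `l ≤ M` changes the
product by a polynomial of degree below `M`, which this derivative kills.

Convergence is delicate only for `m = M`: there `w^{m-j} ζ(M+2-j, w)` decays like `1/w`, but the
real part of `1/w` on the line is `a/|w|²`. -/

namespace HurwitzLog

open MeasureTheory Set Filter Topology FourierTransform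

/-! ### The kernel `t / (1 - e^{-t})`: continuity, bounds, Riccati equation. -/

/-- The continuous kernel `t / (1 - e^{-t})`, with the value `1` at `t = 0`. -/
noncomputable def toddKernel (t : ℝ) : ℝ :=
  (dslope (fun y : ℝ => 1 - Real.exp (-y)) 0 t)⁻¹

theorem hasDerivAt_one_sub_exp_neg (t : ℝ) :
    HasDerivAt (fun y : ℝ => 1 - Real.exp (-y)) (Real.exp (-t)) t := by
  simpa using ((hasDerivAt_neg t).exp.const_sub 1)

theorem toddKernel_zero : toddKernel 0 = 1 := by
  simp [toddKernel, dslope_same, (hasDerivAt_one_sub_exp_neg 0).deriv]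

theorem toddKernel_of_ne {t : ℝ} (ht : t ≠ 0) : toddKernel t = t / (1 - Real.exp (-t)) := by
  simp [toddKernel, dslope_of_ne _ ht, slope_def_field]

theorem one_sub_exp_neg_pos {t : ℝ} (ht : 0 < t) : 0 < 1 - Real.exp (-t) := by
  have : Real.exp (-t) < 1 := by simpa using ht
  linarith

theorem one_sub_exp_neg_ne {t : ℝ} (ht : t ≠ 0) : 1 - Real.exp (-t) ≠ 0 := by
  intro h
  have h1 : Real.exp (-t) = 1 := by linarith
  rw [Real.exp_eq_one_iff] at h1
  exact ht (by linarith)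

@[fun_prop]
theorem continuous_toddKernel : Continuous toddKernel := by
  -- The singularity at `0` is removable because continuity of the divided slope there is just
  -- differentiability of `1 - e^{-y}`.
  have hc : Continuous (dslope (fun y : ℝ => 1 - Real.exp (-y)) 0) := by
    rw [← continuousOn_univ, continuousOn_dslope univ_mem]
    exact ⟨by fun_prop, (hasDerivAt_one_sub_exp_neg 0).differentiableAt⟩
  refine hc.inv₀ fun t => ?_
  rcases eq_or_ne t 0 with rfl | ht
  · simp [dslope_same, (hasDerivAt_one_sub_exp_neg 0).deriv]
  · rw [dslope_of_ne _ ht, slope_def_field]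
    simpa using ⟨one_sub_exp_neg_ne ht, ht⟩

theorem one_le_toddKernel {t : ℝ} (ht : 0 ≤ t) : 1 ≤ toddKernel t := by
  rcases ht.eq_or_lt with rfl | h
  · rw [toddKernel_zero]
  · rw [toddKernel_of_ne h.ne', one_le_div (one_sub_exp_neg_pos h)]
    have := Real.add_one_le_exp (-t)
    linarith

theorem toddKernel_le {t : ℝ} (ht : 0 ≤ t) : toddKernel t ≤ 1 + t := by
  rcases ht.eq_or_lt with rfl | h
  · simp [toddKernel_zero]
  · rw [toddKernel_of_ne h.ne', div_le_iff₀ (one_sub_exp_neg_pos h)]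
    have h1 := Real.add_one_le_exp t
    have h2 : Real.exp t * Real.exp (-t) = 1 := by rw [← Real.exp_add]; simp
    nlinarith [Real.exp_pos (-t)]

theorem toddKernel_pos {t : ℝ} (ht : 0 ≤ t) : 0 < toddKernel t :=
  one_pos.trans_le (one_le_toddKernel ht)

theorem one_le_toddKernel_pow (N : ℕ) {t : ℝ} (ht : 0 ≤ t) : 1 ≤ toddKernel t ^ N :=
  one_le_pow₀ (one_le_toddKernel ht)

theorem toddKernel_pow_le (N : ℕ) {t : ℝ} (ht : 0 ≤ t) : toddKernel t ^ N ≤ (1 + t) ^ N :=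
  pow_le_pow_left₀ (toddKernel_pos ht).le (toddKernel_le ht) N

/-- The factor `t` on the right cancels the `1/t` in the Gauss-type integrals near `0`. -/
theorem toddKernel_pow_sub_one_le (N : ℕ) {t : ℝ} (ht : 0 ≤ t) :
    toddKernel t ^ N - 1 ≤ N * t * (1 + t) ^ N := by
  have h1 : (1 + t) ^ N - 1 ≤ N * t * (1 + t) ^ N := by
    induction N with
    | zero => simp
    | succ n ih =>
      have : 1 ≤ (1 + t) ^ n := one_le_pow₀ (by linarith)
      have h3 : 0 ≤ (n : ℝ) * t * (1 + t) ^ n := by positivity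
      rw [pow_succ]; push_cast
      nlinarith [mul_nonneg h3 ht, mul_nonneg ht ht]
  linarith [toddKernel_pow_le N ht]

/-- Substitute `e^{-t} = 1 - t/κ` in the quotient rule. In this Riccati form the derivative of `κ^N`
involves only `κ^N` and `κ^{N+1}`, which is the source of the recurrence in `N`. -/
theorem hasDerivAt_toddKernel {t : ℝ} (ht : 0 < t) :
    HasDerivAt toddKernel ((toddKernel t - toddKernel t ^ 2) / t + toddKernel t) t := by
  have h1 := (hasDerivAt_id t).div (hasDerivAt_one_sub_exp_neg t) (one_sub_exp_neg_pos ht).ne'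
  have h2 : toddKernel =ᶠ[𝓝 t] fun y => id y / (1 - Real.exp (-y)) := by
    filter_upwards [eventually_ne_nhds ht.ne'] with y hy
    simp [toddKernel_of_ne hy]
  refine (h1.congr_of_eventuallyEq h2).congr_deriv ?_
  rw [toddKernel_of_ne ht.ne']
  have := (one_sub_exp_neg_pos ht).ne'
  simp only [id]
  field_simp
  ring

/-! ### Gauss-type integrals and their recurrence. -/

theorem integrableOn_pow_mul_exp (k : ℕ) {x : ℝ} (hx : 0 < x) :
    IntegrableOn (fun t : ℝ => t ^ k * Real.exp (-(x * t))) (Ioi 0) := by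
  have := integrableOn_rpow_mul_exp_neg_mul_rpow (p := 1) (s := k) (b := x)
    (by have : (0 : ℝ) ≤ k := by positivity
        linarith) one_pos hx
  refine this.congr_fun (fun t ht => ?_) measurableSet_Ioi
  simp

theorem integrableOn_one_add_pow_mul_exp (N : ℕ) {x : ℝ} (hx : 0 < x) :
    IntegrableOn (fun t : ℝ => (1 + t) ^ N * Real.exp (-(x * t))) (Ioi 0) := by
  have h1 : (fun t : ℝ => (1 + t) ^ N * Real.exp (-(x * t))) =
      fun t : ℝ => ∑ k ∈ Finset.range (N + 1), (N.choose k : ℝ) *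
        (t ^ k * Real.exp (-(x * t))) := by
    funext t
    rw [add_comm, add_pow, Finset.sum_mul]
    refine Finset.sum_congr rfl fun k _ => ?_
    simp; ring
  rw [h1]
  exact integrable_finsetSum _ fun k _ => (integrableOn_pow_mul_exp k hx).const_mul _

theorem integrableOn_toddKernel_pow_mul_exp (N : ℕ) {x : ℝ} (hx : 0 < x) :
    IntegrableOn (fun t : ℝ => toddKernel t ^ N * Real.exp (-(x * t))) (Ioi 0) := by
  refine (integrableOn_one_add_pow_mul_exp N hx).mono' (by fun_prop) ?_
  filter_upwards [ae_restrict_mem measurableSet_Ioi] with t ht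
  have ht' : (0 : ℝ) ≤ t := le_of_lt ht
  have := toddKernel_pos ht'
  rw [Real.norm_of_nonneg (by positivity)]
  gcongr
  exact toddKernel_le ht'

theorem abs_exp_sub_exp_div_le {x t : ℝ} (ht : 0 < t) :
    |(Real.exp (-t) - Real.exp (-(x * t))) / t| ≤ |x - 1| * Real.exp (-(min 1 x * t)) := by
  have key : ∀ a b : ℝ, a ≤ b → |Real.exp (-(a * t)) - Real.exp (-(b * t))| ≤
      (b - a) * t * Real.exp (-(a * t)) := by
    intro a b hab
    have h1 : Real.exp (-(b * t)) = Real.exp (-(a * t)) * Real.exp (-((b - a) * t)) := by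
      rw [← Real.exp_add]; ring_nf
    have h2 := Real.add_one_le_exp (-((b - a) * t))
    have h3 : Real.exp (-((b - a) * t)) ≤ 1 :=
      Real.exp_le_one_iff.2 (by nlinarith)
    rw [h1, abs_of_nonneg (by nlinarith [Real.exp_pos (-(a * t))])]
    nlinarith [Real.exp_pos (-(a * t))]
  rw [abs_div, abs_of_pos ht, div_le_iff₀ ht]
  rcases le_total 1 x with h | h
  · have := key 1 x h
    rw [min_eq_left h, abs_of_nonneg (by linarith : 0 ≤ x - 1)]
    simp only [one_mul] at *
    linarith
  · have := key x 1 h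
    rw [min_eq_right h, abs_sub_comm, abs_of_nonpos (by linarith : x - 1 ≤ 0)]
    simp only [one_mul] at *
    linarith

/-- The integrand of the Gauss-type integral attached to the `N`-th power of the kernel. -/
noncomputable def gaussIntegrand (N : ℕ) (x t : ℝ) : ℝ :=
  (Real.exp (-t) - toddKernel t ^ N * Real.exp (-(x * t))) / t

/-- The integral `∫₀^∞ (e^{-t} - (t / (1 - e^{-t}))^N e^{-xt}) dt / t`. -/
noncomputable def gaussIntegral (N : ℕ) (x : ℝ) : ℝ :=
  ∫ t in Ioi (0 : ℝ), gaussIntegrand N x t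

theorem measurable_gaussIntegrand (N : ℕ) (x : ℝ) : Measurable (gaussIntegrand N x) := by
  have := continuous_toddKernel.measurable
  unfold gaussIntegrand
  fun_prop

theorem abs_toddKernel_sub_one_mul_exp_div_le (N : ℕ) (x : ℝ) {t : ℝ} (ht : 0 < t) :
    |(toddKernel t ^ N - 1) * Real.exp (-(x * t)) / t| ≤
      N * ((1 + t) ^ N * Real.exp (-(x * t))) := by
  have h2 := one_le_toddKernel_pow N ht.le
  have h3 := toddKernel_pow_sub_one_le N ht.le
  have h4 : 0 ≤ toddKernel t ^ N - 1 := by linarith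
  rw [abs_of_nonneg (by positivity), div_le_iff₀ ht]
  nlinarith [mul_le_mul_of_nonneg_right h3 (Real.exp_pos (-(x * t))).le]

theorem integrableOn_toddKernel_sub_one (N : ℕ) {x : ℝ} (hx : 0 < x) :
    IntegrableOn (fun t => (toddKernel t ^ N - 1) * Real.exp (-(x * t)) / t) (Ioi 0) := by
  refine ((integrableOn_one_add_pow_mul_exp N hx).const_mul (N : ℝ)).mono' ?_ ?_
  · have := continuous_toddKernel.measurable
    exact Measurable.aestronglyMeasurable (by fun_prop)
  · filter_upwards [ae_restrict_mem measurableSet_Ioi] with t ht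
    exact abs_toddKernel_sub_one_mul_exp_div_le N x ht

theorem integrableOn_exp_sub_exp_div {x : ℝ} (hx : 0 < x) :
    IntegrableOn (fun t => (Real.exp (-t) - Real.exp (-(x * t))) / t) (Ioi 0) := by
  have hm : 0 < min 1 x := lt_min one_pos hx
  have h0 := (integrableOn_one_add_pow_mul_exp 0 hm).const_mul |x - 1|
  simp only [pow_zero, one_mul] at h0
  refine Integrable.mono' h0 (Measurable.aestronglyMeasurable (by fun_prop)) ?_
  filter_upwards [ae_restrict_mem measurableSet_Ioi] with t ht
  exact abs_exp_sub_exp_div_le ht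

/-- Separates a Frullani part from a part where `κ^N - 1 = O(t)` near `0`; each is integrable by
itself. -/
theorem gaussIntegrand_eq (N : ℕ) (x t : ℝ) :
    gaussIntegrand N x t = (Real.exp (-t) - Real.exp (-(x * t))) / t -
      (toddKernel t ^ N - 1) * Real.exp (-(x * t)) / t := by
  unfold gaussIntegrand; ring

theorem integrableOn_gaussIntegrand (N : ℕ) {x : ℝ} (hx : 0 < x) :
    IntegrableOn (gaussIntegrand N x) (Ioi 0) := by
  rw [funext (gaussIntegrand_eq N x)]
  exact (integrableOn_exp_sub_exp_div hx).sub (integrableOn_toddKernel_sub_one N hx)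

/-- Differentiation under the integral cancels the `1/t`; for `y > x/2` the derivative is dominated
by its value at `x/2`. -/
theorem hasDerivAt_gaussIntegral (N : ℕ) {x : ℝ} (hx : 0 < x) :
    HasDerivAt (gaussIntegral N)
      (∫ t in Ioi (0 : ℝ), toddKernel t ^ N * Real.exp (-(x * t))) x := by
  have hx2 : 0 < x / 2 := by positivity
  refine (hasDerivAt_integral_of_dominated_loc_of_deriv_le (F := gaussIntegrand N)
    (F' := fun x t => toddKernel t ^ N * Real.exp (-(x * t))) (x₀ := x)
    (s := Ioi (x / 2)) (Ioi_mem_nhds (by linarith))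
    (Eventually.of_forall fun y => (measurable_gaussIntegrand N y).aestronglyMeasurable)
    (integrableOn_gaussIntegrand N hx) (by fun_prop) ?_
    (integrableOn_toddKernel_pow_mul_exp N hx2) ?_).2
  · filter_upwards [ae_restrict_mem measurableSet_Ioi] with t ht y hy
    have ht' : 0 < t := ht
    have := toddKernel_pos ht'.le
    rw [Real.norm_of_nonneg (by positivity)]
    have hy' : x / 2 < y := hy
    gcongr
  · filter_upwards [ae_restrict_mem measurableSet_Ioi] with t ht y hy
    have ht' : t ≠ 0 := ne_of_gt ht
    have h1 : HasDerivAt (fun y => Real.exp (-(y * t))) (Real.exp (-(y * t)) * (-(1 * t))) y :=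
      ((hasDerivAt_id y).mul_const t).neg.exp
    refine (((h1.const_mul (toddKernel t ^ N)).const_sub (Real.exp (-t))).div_const t).congr_deriv ?_
    field_simp

theorem tendsto_one_add_pow_mul_exp (N : ℕ) {x : ℝ} (hx : 0 < x) :
    Tendsto (fun t : ℝ => (1 + t) ^ N * Real.exp (-(x * t))) atTop (𝓝 0) := by
  -- Use `y^N e^{-y} → 0` along `y = x + xt = x(1 + t)`, then remove the constants `x^N` and
  -- `e^{-x}`.
  have hA := (Real.tendsto_pow_mul_exp_neg_atTop_nhds_zero N).comp
    (tendsto_atTop_add_const_left atTop x (tendsto_id.const_mul_atTop hx))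
  have hB := hA.const_mul ((1 / x) ^ N * Real.exp x)
  rw [mul_zero] at hB
  refine hB.congr fun t => ?_
  simp only [Function.comp, id]
  have : Real.exp (-(x + x * t)) = Real.exp (-x) * Real.exp (-(x * t)) := by
    rw [← Real.exp_add]; ring_nf
  have h2 : Real.exp x * Real.exp (-x) = 1 := by rw [← Real.exp_add]; simp
  rw [this, show x + x * t = x * (1 + t) by ring, mul_pow, one_div, inv_pow]
  have hxN : x ^ N ≠ 0 := by positivity
  have h3 := inv_mul_cancel₀ hxN
  linear_combination (1 + t) ^ N * Real.exp (-(x * t)) * Real.exp x * Real.exp (-x) * h3 +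
    (1 + t) ^ N * Real.exp (-(x * t)) * h2

/-- Integrate the derivative of `q = κ^N e^{-xt}` over the half-line. By the Riccati equation it
equals `N` times the difference of the two Gauss integrands minus `(x - N) q`, and the boundary term
is `0 - q(0) = -1`. -/
theorem gaussIntegral_succ (N : ℕ) {x : ℝ} (hx : 0 < x) :
    N * (gaussIntegral (N + 1) x - gaussIntegral N x) =
      -1 + (x - N) * ∫ t in Ioi (0 : ℝ), toddKernel t ^ N * Real.exp (-(x * t)) := by
  set q : ℝ → ℝ := fun t => toddKernel t ^ N * Real.exp (-(x * t)) with hq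
  set q' : ℝ → ℝ := fun t =>
    N * (gaussIntegrand (N + 1) x t - gaussIntegrand N x t) - (x - N) * q t with hq'
  have hqi : IntegrableOn q (Ioi 0) := integrableOn_toddKernel_pow_mul_exp N hx
  have hgi := ((integrableOn_gaussIntegrand (N + 1) hx).sub
    (integrableOn_gaussIntegrand N hx)).const_mul (N : ℝ)
  have hq'i : IntegrableOn q' (Ioi 0) := hgi.sub (hqi.const_mul (x - N))
  have hd : ∀ t ∈ Ioi (0 : ℝ), HasDerivAt q (q' t) t := by
    intro t ht
    have ht0 : t ≠ 0 := ne_of_gt ht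
    have h1 : HasDerivAt (fun t => Real.exp (-(x * t))) (Real.exp (-(x * t)) * (-(x * 1))) t :=
      ((hasDerivAt_id t).const_mul x).neg.exp
    refine (((hasDerivAt_toddKernel ht).pow N).mul h1).congr_deriv ?_
    simp only [hq', hq, gaussIntegrand, Pi.pow_apply]
    rcases N with _ | n
    · simp [mul_comm]
    · rw [Nat.add_sub_cancel]
      field_simp
      ring
  have hlim : Tendsto q atTop (𝓝 0) := by
    refine squeeze_zero' ?_ ?_ (tendsto_one_add_pow_mul_exp N hx)
    · filter_upwards [eventually_ge_atTop 0] with t ht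
      have := toddKernel_pos ht
      positivity
    · filter_upwards [eventually_ge_atTop 0] with t ht
      exact mul_le_mul_of_nonneg_right (toddKernel_pow_le N ht) (Real.exp_pos _).le
  have hint := integral_Ioi_of_hasDerivAt_of_tendsto
    (by fun_prop : Continuous q).continuousWithinAt hd hq'i hlim
  have hq0 : q 0 = 1 := by simp [hq, toddKernel_zero]
  have hsplit : ∫ t in Ioi (0 : ℝ), q' t =
      N * (gaussIntegral (N + 1) x - gaussIntegral N x) - (x - N) * ∫ t in Ioi (0 : ℝ), q t := by
    unfold gaussIntegral
    rw [← integral_sub (integrableOn_gaussIntegrand (N + 1) hx) (integrableOn_gaussIntegrand N hx),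
      ← integral_const_mul, ← integral_const_mul]
    exact integral_sub hgi (hqi.const_mul _)
  linarith

theorem gaussIntegral_zero {x : ℝ} (hx : 0 < x) : gaussIntegral 0 x = Real.log x := by
  have h := Frullani.integral_Ioi_eq (f := fun t : ℝ => Real.exp (-t)) (a := 1) (b := x)
    (L := 1) (R := 0)
    ((by fun_prop : Continuous fun t : ℝ => Real.exp (-t)).locallyIntegrable.locallyIntegrableOn _)
    one_pos hx ?_ ?_ ?_
  · simp only [one_mul, smul_eq_mul, div_one, sub_zero, mul_one] at h
    rw [← h]
    refine integral_congr_ae (Eventually.of_forall fun t => ?_)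
    simp [gaussIntegrand, div_eq_inv_mul]
  · have : ContinuousAt (fun t : ℝ => Real.exp (-t)) 0 := by fun_prop
    have h2 := this.tendsto
    simp only [neg_zero, Real.exp_zero] at h2
    exact h2.mono_left nhdsWithin_le_nhds
  · exact Real.tendsto_exp_neg_atTop_nhds_zero
  · refine (integrableOn_exp_sub_exp_div hx).congr (Eventually.of_forall fun t => ?_)
    simp [div_eq_inv_mul]

/-! ### The digamma function and Gauss' formula. -/

theorem digamma_add_one {x : ℝ} (hx : 0 < x) : digamma (x + 1) = digamma x + 1 / x := by
  have h := Complex.digamma_apply_add_one (x : ℂ) fun m h => by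
    have h' : x = -(m : ℝ) := by exact_mod_cast h
    have : (0 : ℝ) ≤ m := Nat.cast_nonneg m
    linarith
  have h1 := ofReal_digamma hx
  have h2 := ofReal_digamma (by linarith : 0 < x + 1)
  push_cast at h2
  rw [← h1, ← h2] at h
  have : digamma (x + 1) = digamma x + x⁻¹ := by exact_mod_cast h
  rw [this, one_div]

theorem contDiffAt_digamma {x : ℝ} (hx : 0 < x) (n : ℕ∞) : ContDiffAt ℝ n digamma x := by
  have hopen : IsOpen {w : ℂ | 0 < w.re} := isOpen_lt continuous_const Complex.continuous_re
  have hd : DifferentiableOn ℂ Complex.Gamma {w : ℂ | 0 < w.re} := fun w hw =>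
    (Complex.differentiableAt_Gamma _ fun m h => by
      have hw' : 0 < w.re := hw
      have : (0 : ℝ) ≤ m := Nat.cast_nonneg m
      rw [h] at hw'
      simp at hw'
      linarith).differentiableWithinAt
  have ha : AnalyticAt ℂ Complex.Gamma (x : ℂ) :=
    hd.analyticAt (hopen.mem_nhds (by simpa using hx))
  have hdig : AnalyticAt ℂ Complex.digamma (x : ℂ) := by
    refine ha.deriv.div ha (Complex.Gamma_ne_zero_of_re_pos (by simpa using hx))
  refine (hdig.contDiffAt (n := n)).real_of_complex.congr_of_eventuallyEq ?_
  filter_upwards [Ioi_mem_nhds hx] with y hy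
  rw [← ofReal_digamma hy, Complex.ofReal_re]

theorem hasDerivAt_log_Gamma {x : ℝ} (hx : 0 < x) :
    HasDerivAt (Real.log ∘ Real.Gamma) (digamma x) x := by
  have hd : DifferentiableAt ℝ Real.Gamma x := by
    refine Real.differentiableAt_Gamma fun m => ?_
    have : (0 : ℝ) ≤ m := Nat.cast_nonneg m
    intro h
    linarith
  exact hd.hasDerivAt.log (Real.Gamma_pos_of_pos hx).ne'

theorem log_Gamma_add_one_sub {x : ℝ} (hx : 0 < x) :
    (Real.log ∘ Real.Gamma) (x + 1) - (Real.log ∘ Real.Gamma) x = Real.log x := by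
  simp only [Function.comp]
  rw [Real.Gamma_add_one hx.ne', Real.log_mul hx.ne' (Real.Gamma_pos_of_pos hx).ne']
  ring

/-- `log Γ` is convex and its chord over `[x, x+1]` has slope `log x`, so the derivative at the left
end is at most `log x`; the next lemma is the bound at the right end. -/
theorem digamma_le_log {x : ℝ} (hx : 0 < x) : digamma x ≤ Real.log x := by
  have := Real.convexOn_log_Gamma.le_slope_of_hasDerivAt (x := x) (y := x + 1) hx
    (by show (0 : ℝ) < x + 1; linarith) (by linarith) (hasDerivAt_log_Gamma hx)
  rw [slope_def_field, log_Gamma_add_one_sub hx] at this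
  simpa using this

theorem log_le_digamma_add_one {x : ℝ} (hx : 0 < x) : Real.log x ≤ digamma (x + 1) := by
  have hx1 : (0 : ℝ) < x + 1 := by linarith
  have := Real.convexOn_log_Gamma.slope_le_of_hasDerivAt (x := x) (y := x + 1) hx
    hx1 (by linarith) (hasDerivAt_log_Gamma hx1)
  rw [slope_def_field, log_Gamma_add_one_sub hx] at this
  simpa using this

theorem abs_digamma_sub_log_le {x : ℝ} (hx : 0 < x) : |digamma x - Real.log x| ≤ 1 / x := by
  have h1 := digamma_le_log hx
  have h2 := log_le_digamma_add_one hx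
  rw [digamma_add_one hx] at h2
  rw [abs_of_nonpos (by linarith)]
  linarith

/-- Since `κ (1 - e^{-t}) = t`, the difference of the integrands is simply `e^{-xt}`. -/
theorem gaussIntegral_one_add_one {x : ℝ} (hx : 0 < x) :
    gaussIntegral 1 (x + 1) = gaussIntegral 1 x + 1 / x := by
  have hx1 : (0 : ℝ) < x + 1 := by linarith
  have h : gaussIntegral 1 (x + 1) - gaussIntegral 1 x = 1 / x := by
    unfold gaussIntegral
    rw [← integral_sub (integrableOn_gaussIntegrand 1 hx1) (integrableOn_gaussIntegrand 1 hx)]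
    have := integral_exp_mul_Ioi (a := -x) (by linarith) 0
    rw [mul_zero, Real.exp_zero, neg_div_neg_eq] at this
    rw [← this]
    refine setIntegral_congr_fun measurableSet_Ioi fun t ht => ?_
    have ht0 : t ≠ 0 := ne_of_gt ht
    have h1 := (one_sub_exp_neg_pos ht).ne'
    have h2 : Real.exp (-((x + 1) * t)) = Real.exp (-x * t) * Real.exp (-t) := by
      rw [← Real.exp_add]; ring_nf
    simp only [gaussIntegrand, pow_one]
    rw [toddKernel_of_ne ht0, h2, neg_mul]
    field_simp
    ring
  linarith

theorem abs_gaussIntegral_one_sub_log_le {x : ℝ} (hx : 0 < x) :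
    |gaussIntegral 1 x - Real.log x| ≤ 1 / x := by
  rw [← gaussIntegral_zero hx]
  unfold gaussIntegral
  rw [← integral_sub (integrableOn_gaussIntegrand 1 hx) (integrableOn_gaussIntegrand 0 hx)]
  have h1 := integral_exp_mul_Ioi (a := -x) (by linarith) 0
  rw [mul_zero, Real.exp_zero, neg_div_neg_eq] at h1
  rw [← h1, ← Real.norm_eq_abs]
  refine norm_integral_le_of_norm_le (integrableOn_exp_mul_Ioi (by linarith) 0) ?_
  filter_upwards [ae_restrict_mem measurableSet_Ioi] with t ht
  have ht' : 0 < t := ht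
  have h2 := one_le_toddKernel ht'.le
  have h3 := toddKernel_le ht'.le
  have h4 : gaussIntegrand 1 x t - gaussIntegrand 0 x t =
      -((toddKernel t - 1) / t * Real.exp (-x * t)) := by
    simp only [gaussIntegrand, pow_one, pow_zero, neg_mul]
    field_simp
    ring
  have h5 : 0 ≤ (toddKernel t - 1) / t := div_nonneg (by linarith) ht'.le
  have h6 : (toddKernel t - 1) / t ≤ 1 := by rw [div_le_one ht']; linarith
  rw [h4, norm_neg, Real.norm_of_nonneg (by positivity)]
  exact mul_le_of_le_one_left (Real.exp_pos _).le h6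

/-- Gauss' integral representation of the digamma function. -/
theorem digamma_eq_gaussIntegral {x : ℝ} (hx : 0 < x) : digamma x = gaussIntegral 1 x := by
  -- Both functions gain `1/x` under `x ↦ x + 1`, so their difference is unchanged by integer
  -- shifts; both are within `1/x` of `log x`, so it tends to `0` along the shifts and hence
  -- vanishes.
  have h1 : ∀ n : ℕ, digamma (x + n) - gaussIntegral 1 (x + n) =
      digamma x - gaussIntegral 1 x := by
    intro n
    induction n with
    | zero => simp
    | succ n ih =>
      have hn : 0 < x + n := by positivity
      push_cast
      rw [← ih, ← add_assoc, digamma_add_one hn, gaussIntegral_one_add_one hn]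
      ring
  have h2 : Tendsto (fun n : ℕ => 2 * (1 / (x + n))) atTop (𝓝 0) := by
    have : Tendsto (fun n : ℕ => x + (n : ℝ)) atTop atTop :=
      tendsto_atTop_add_const_left _ _ tendsto_natCast_atTop_atTop
    simpa using (this.inv_tendsto_atTop).const_mul 2
  have h3 : Tendsto (fun _ : ℕ => digamma x - gaussIntegral 1 x) atTop (𝓝 0) := by
    refine squeeze_zero_norm (fun n => ?_) h2
    have hn : 0 < x + n := by positivity
    have ha := abs_le.1 (abs_digamma_sub_log_le hn)
    have hb := abs_le.1 (abs_gaussIntegral_one_sub_log_le hn)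
    rw [← h1 n, Real.norm_eq_abs, abs_le]
    constructor <;> linarith
  have := tendsto_nhds_unique h3 tendsto_const_nhds
  linarith

/-! ### Higher derivatives of binomial times digamma. -/

theorem iteratedDeriv_sub_const_mul (n : ℕ) (b x : ℝ) {g : ℝ → ℝ}
    (hg : ContDiffAt ℝ (n + 1 : ℕ) g x) :
    iteratedDeriv (n + 1) (fun t => (t - b) * g t) x =
      (x - b) * iteratedDeriv (n + 1) g x + (n + 1) * iteratedDeriv n g x := by
  have hd : deriv (fun t : ℝ => t - b) = fun _ => 1 := by
    funext t; simp
  have h := iteratedDeriv_mul (f := fun t : ℝ => t - b) (g := g) (n := n + 1) (x := x)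
    (by fun_prop) hg
  have hfun : (fun t : ℝ => t - b) * g = fun t => (t - b) * g t := rfl
  rw [hfun, Finset.sum_range_succ', Finset.sum_range_succ'] at h
  rw [h, Finset.sum_eq_zero, iteratedDeriv_succ', hd]
  · simp; ring
  · intro i _
    rw [iteratedDeriv_succ', hd, iteratedDeriv_succ']
    simp

theorem binom_succ (x : ℝ) (n : ℕ) :
    binom x (n + 1) = 1 / ((n : ℝ) + 1) * ((x - n) * binom x n) := by
  have : (n.factorial : ℝ) ≠ 0 := by positivity
  unfold binom
  rw [Finset.prod_range_succ, Nat.factorial_succ]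
  push_cast
  field_simp

theorem contDiff_binom (n : ℕ) (k : ℕ∞) : ContDiff ℝ k (fun t : ℝ => binom (t - 1) n) := by
  unfold binom
  fun_prop

/-- Induction on `n`: passing to `n + 1` multiplies by `(t - (n+1))/(n+1)`, and Leibniz' rule leaves
two terms. The one with the extra derivative is supplied by `gaussIntegral_succ`, whose `-1` becomes
the new harmonic summand `1/(n+1)`. -/
theorem iteratedDeriv_binom_mul_digamma (n : ℕ) {x : ℝ} (hx : 0 < x) :
    iteratedDeriv n (fun t => binom (t - 1) n * digamma t) x =
      (harmonic n : ℝ) + gaussIntegral (n + 1) x := by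
  induction n generalizing x with
  | zero => simp [binom, digamma_eq_gaussIntegral hx]
  | succ n ih =>
    set g : ℝ → ℝ := fun t => binom (t - 1) n * digamma t with hg
    have hgc : ContDiffAt ℝ (n + 1 : ℕ) g x :=
      ((contDiff_binom n (n + 1 : ℕ)).contDiffAt).mul (contDiffAt_digamma hx (n + 1 : ℕ))
    have h1 : (fun t => binom (t - 1) (n + 1) * digamma t) =
        fun t => 1 / ((n : ℝ) + 1) * ((t - (n + 1)) * g t) := by
      funext t
      rw [binom_succ, hg]
      ring
    have h2 : iteratedDeriv (n + 1) g x =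
        ∫ t in Ioi (0 : ℝ), toddKernel t ^ (n + 1) * Real.exp (-(x * t)) := by
      rw [iteratedDeriv_succ]
      have : iteratedDeriv n g =ᶠ[𝓝 x] fun y => (harmonic n : ℝ) + gaussIntegral (n + 1) y := by
        filter_upwards [Ioi_mem_nhds hx] with y hy
        exact ih hy
      rw [this.deriv_eq]
      exact ((hasDerivAt_gaussIntegral (n + 1) hx).const_add _).deriv
    have h3 := gaussIntegral_succ (n + 1) hx
    rw [h1, iteratedDeriv_const_mul_field, iteratedDeriv_sub_const_mul n _ x hgc, ih hx, h2,
      harmonic_succ]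
    push_cast at h3 ⊢
    have : (n : ℝ) + 1 ≠ 0 := by positivity
    field_simp
    linarith

theorem iteratedDeriv_polynomial_eval (n : ℕ) (p : Polynomial ℝ) :
    iteratedDeriv n (fun t => p.eval t) = fun t => (Polynomial.derivative^[n] p).eval t := by
  induction n with
  | zero => simp
  | succ n ih =>
    rw [iteratedDeriv_succ, ih, Function.iterate_succ_apply']
    funext t
    exact Polynomial.deriv _

theorem digamma_eq_sub_natCast (l : ℕ) {x : ℝ} (hx : (l : ℝ) < x) :
    digamma x = digamma (x - l) + ∑ i ∈ Finset.range l, 1 / (x - 1 - i) := by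
  induction l generalizing x with
  | zero => simp
  | succ l ih =>
    push_cast at hx
    have h := digamma_add_one (by linarith : 0 < x - (l + 1))
    rw [show x - ((l : ℝ) + 1) + 1 = x - l by ring] at h
    rw [ih (by linarith), h, Finset.sum_range_succ]
    push_cast
    rw [show x - ((l : ℝ) + 1) = x - 1 - l by ring]
    ring

/-- `ψ(t) - ψ(t - l)` is a sum of `1/(t - 1 - i)` with `i < l ≤ n`. Each pole cancels a factor of
`binom (t - 1) n`, leaving the polynomial `p` of degree below `n`. -/
theorem iteratedDeriv_binom_mul_digamma_sub {n l : ℕ} (hl : l ≤ n) {x : ℝ} (hx : (l : ℝ) < x) :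
    iteratedDeriv n (fun t => binom (t - 1) n * digamma (t - l)) x =
      iteratedDeriv n (fun t => binom (t - 1) n * digamma t) x := by
  have hx0 : 0 < x := lt_of_le_of_lt (Nat.cast_nonneg l) hx
  set p : Polynomial ℝ := Polynomial.C (1 / (n.factorial : ℝ)) * ∑ i ∈ Finset.range l,
    ∏ r ∈ (Finset.range n).erase i, (Polynomial.X - Polynomial.C (1 + (r : ℝ))) with hp
  rcases Nat.eq_zero_or_pos l with rfl | hl0
  · simp
  have hdeg : p.natDegree < n := by
    refine lt_of_le_of_lt (Polynomial.natDegree_C_mul_le _ _) ?_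
    refine lt_of_le_of_lt (Polynomial.natDegree_sum_le_of_forall_le (n := n - 1) _ _ ?_) (by omega)
    intro i hi
    have hi' : i ∈ Finset.range n := by
      simp only [Finset.mem_range] at *
      omega
    rw [Polynomial.natDegree_prod_of_monic _ _ fun r _ => Polynomial.monic_X_sub_C _]
    simp only [Polynomial.natDegree_X_sub_C]
    simp [Finset.card_erase_of_mem hi']
  have heq : (fun t => binom (t - 1) n * digamma t) =ᶠ[𝓝 x]
      fun t => binom (t - 1) n * digamma (t - l) + p.eval t := by
    filter_upwards [Ioi_mem_nhds hx] with t ht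
    rw [digamma_eq_sub_natCast l ht, mul_add, hp, Polynomial.eval_mul, Polynomial.eval_C,
      Polynomial.eval_finsetSum, Finset.mul_sum, Finset.mul_sum]
    congr 1
    refine Finset.sum_congr rfl fun i hi => ?_
    have hil : i + 1 ≤ l := Finset.mem_range.1 hi
    have hi' : i ∈ Finset.range n := Finset.mem_range.2 (by omega)
    have hne : t - 1 - i ≠ 0 := by
      have h1 : (l : ℝ) < t := ht
      have h2 : (i : ℝ) + 1 ≤ l := by exact_mod_cast hil
      intro h
      linarith
    rw [Polynomial.eval_prod, binom, ← Finset.mul_prod_erase _ _ hi']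
    simp only [Polynomial.eval_sub, Polynomial.eval_X, Polynomial.eval_C, sub_add_eq_sub_sub]
    field_simp
  have hc1 : ContDiffAt ℝ n (fun t => binom (t - 1) n * digamma (t - l)) x := by
    refine ((contDiff_binom n n).contDiffAt).mul ?_
    exact (contDiffAt_digamma (by linarith : 0 < x - l) n).comp x (by fun_prop)
  have hc2 : ContDiffAt ℝ n (fun t => p.eval t) x := by
    simpa using (p.contDiff_aeval (𝕜 := ℝ) n).contDiffAt
  rw [heq.iteratedDeriv_eq, iteratedDeriv_fun_add hc1 hc2, iteratedDeriv_polynomial_eval,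
    Polynomial.iterate_derivative_eq_zero hdeg]
  simp

/-! ### The rising series as a Laplace transform. -/

theorem norm_pow_mul_cexp (k : ℕ) (z : ℂ) {t : ℝ} (ht : 0 ≤ t) :
    ‖(t : ℂ) ^ k * Complex.exp (-(z * t))‖ = t ^ k * Real.exp (-(z.re * t)) := by
  rw [norm_mul, norm_pow, Complex.norm_exp, Complex.norm_of_nonneg ht]
  simp

theorem integrableOn_pow_mul_cexp (k : ℕ) {z : ℂ} (hz : 0 < z.re) :
    IntegrableOn (fun t : ℝ => (t : ℂ) ^ k * Complex.exp (-(z * t))) (Ioi 0) := by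
  refine (integrableOn_pow_mul_exp k hz).mono' (by fun_prop) ?_
  filter_upwards [ae_restrict_mem measurableSet_Ioi] with t ht
  exact (norm_pow_mul_cexp k z (le_of_lt ht)).le

theorem integral_pow_mul_cexp (k : ℕ) {z : ℂ} (hz : 0 < z.re) :
    ∫ t in Ioi (0 : ℝ), (t : ℂ) ^ k * Complex.exp (-(z * t)) = k.factorial / z ^ (k + 1) := by
  have hz0 : z ≠ 0 := fun h => by simp [h] at hz
  induction k with
  | zero =>
    have := integral_exp_mul_complex_Ioi (a := -z) (by simpa using hz) 0
    simpa using this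
  | succ k ih =>
    have hd : ∀ t ∈ Ioi (0 : ℝ), HasDerivAt
        (fun t : ℝ => (t : ℂ) ^ (k + 1) * Complex.exp (-(z * t)))
        ((k + 1) * ((t : ℂ) ^ k * Complex.exp (-(z * t))) -
          z * ((t : ℂ) ^ (k + 1) * Complex.exp (-(z * t)))) t := by
      intro t _
      have h1 : HasDerivAt (fun w : ℂ => w ^ (k + 1) * Complex.exp (-(z * w)))
          (((k + 1 : ℕ) : ℂ) * (t : ℂ) ^ k * Complex.exp (-(z * t)) +
            (t : ℂ) ^ (k + 1) * (Complex.exp (-(z * t)) * (-(z * 1)))) (t : ℂ) := by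
        have := (hasDerivAt_pow (k + 1) (t : ℂ)).mul
          (((hasDerivAt_id (t : ℂ)).const_mul z).neg.cexp)
        refine this.congr_deriv ?_
        simp
      refine h1.comp_ofReal.congr_deriv ?_
      push_cast
      ring
    have hlim : Tendsto (fun t : ℝ => (t : ℂ) ^ (k + 1) * Complex.exp (-(z * t))) atTop (𝓝 0) := by
      refine squeeze_zero_norm' ?_ (tendsto_one_add_pow_mul_exp (k + 1) hz)
      filter_upwards [eventually_ge_atTop 0] with t ht
      rw [norm_pow_mul_cexp _ _ ht]
      gcongr
      linarith
    have hi1 := (integrableOn_pow_mul_cexp k hz).const_mul ((k : ℂ) + 1)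
    have hi2 := (integrableOn_pow_mul_cexp (k + 1) hz).const_mul z
    have h := integral_Ioi_of_hasDerivAt_of_tendsto
      (by fun_prop : Continuous fun t : ℝ =>
        (t : ℂ) ^ (k + 1) * Complex.exp (-(z * t))).continuousWithinAt hd (hi1.sub hi2) hlim
    rw [integral_sub hi1 hi2, integral_const_mul, integral_const_mul, ih] at h
    simp only [Complex.ofReal_zero, ne_eq, Nat.add_eq_zero_iff, one_ne_zero, and_false,
      not_false_eq_true, zero_pow, zero_mul, sub_zero] at h
    rw [eq_div_iff (pow_ne_zero _ hz0), Nat.factorial_succ]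
    have hzk : z ^ (k + 1) ≠ 0 := pow_ne_zero _ hz0
    field_simp at h
    push_cast
    linear_combination -h

/-- The Dirichlet-type series `∑_n (n + 1)(n + 2) ⋯ (n + M) / (n + w)^{M + 2}`. -/
noncomputable def risingSeries (M : ℕ) (w : ℂ) : ℂ :=
  ∑' n : ℕ, ((n + 1).ascFactorial M : ℂ) / ((n : ℂ) + w) ^ (M + 2)

theorem summable_ascFactorial_div (M : ℕ) {x : ℝ} (hx : 0 < x) :
    Summable fun n : ℕ => ((n + 1).ascFactorial M : ℝ) / ((n : ℝ) + x) ^ (M + 2) := by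
  have h0 := ((Real.summable_one_div_nat_add_rpow x 2).2 one_lt_two).mul_left ((1 + M / x) ^ M)
  refine Summable.of_nonneg_of_le (fun n => by positivity) (fun n => ?_) h0
  have hn : 0 < (n : ℝ) + x := by positivity
  have h1 : ((n + 1).ascFactorial M : ℝ) ≤ ((1 + M / x) * (n + x)) ^ M := by
    refine le_trans (by exact_mod_cast Nat.ascFactorial_le_pow_add n M :
      ((n + 1).ascFactorial M : ℝ) ≤ ((n : ℝ) + M) ^ M) ?_
    have : (1 + M / x) * (n + x) = n + M + (x + M * n / x) := by field_simp; ring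
    rw [this]
    have : 0 ≤ x + M * n / x := by positivity
    exact pow_le_pow_left₀ (by positivity) (by linarith) _
  rw [abs_of_pos hn, Real.rpow_two, pow_add, div_le_iff₀ (by positivity)]
  refine h1.trans (le_of_eq ?_)
  rw [mul_pow]
  field_simp

/-- The negative binomial series for `(1 - e^{-t})^{-(M+1)}`. -/
theorem hasSum_toddKernel_pow (M : ℕ) {t : ℝ} (ht : 0 < t) :
    HasSum (fun n : ℕ => ((n + M).choose M : ℂ) * (t : ℂ) ^ (M + 1) * Complex.exp (-(n * t)))
      ((toddKernel t : ℂ) ^ (M + 1)) := by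
  have hr : ‖Complex.exp (-t)‖ < 1 := by
    rw [Complex.norm_exp]
    simpa using ht
  have h := (hasSum_choose_mul_geometric_of_norm_lt_one M hr).mul_left ((t : ℂ) ^ (M + 1))
  have h1 : (toddKernel t : ℂ) ^ (M + 1) =
      (t : ℂ) ^ (M + 1) * (1 / (1 - Complex.exp (-t)) ^ (M + 1)) := by
    rw [toddKernel_of_ne ht.ne']
    push_cast
    rw [div_pow]
    ring
  rw [h1]
  refine h.congr_fun fun n => ?_
  rw [← Complex.exp_nat_mul]
  ring_nf

/-- The series is a Laplace transform. -/
theorem integral_toddKernel_pow_mul_cexp (M : ℕ) {w : ℂ} (hw : 0 < w.re) :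
    ∫ t in Ioi (0 : ℝ), (toddKernel t : ℂ) ^ (M + 1) * Complex.exp (-(w * t)) =
      (M + 1) * risingSeries M w := by
  set f : ℕ → ℝ → ℂ := fun n t =>
    ((n + M).choose M : ℂ) * ((t : ℂ) ^ (M + 1) * Complex.exp (-((n + w) * t))) with hf
  have hre : ∀ n : ℕ, ((n : ℂ) + w).re = n + w.re := fun n => by simp
  have hpos : ∀ n : ℕ, 0 < ((n : ℂ) + w).re := fun n => by rw [hre]; positivity
  have hfac : ∀ n : ℕ, (M.factorial : ℝ) * (n + M).choose M = (n + 1).ascFactorial M := fun n => by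
    rw [Nat.ascFactorial_eq_factorial_mul_choose]; push_cast; ring
  have hint : ∀ n, IntegrableOn (f n) (Ioi 0) := fun n =>
    (integrableOn_pow_mul_cexp (M + 1) (hpos n)).const_mul _
  -- The norms integrate to the same expression at the real point `w.re`. The factor `M + 1` arises
  -- from `(M+1)! · choose (n+M) M = (M+1) · (n+1)⋯(n+M)`.
  have hsum : Summable fun n => ∫ t in Ioi (0 : ℝ), ‖f n t‖ := by
    have hs := (summable_ascFactorial_div M hw).mul_left ((M : ℝ) + 1)
    refine hs.congr fun n => ?_
    have h1 : ∀ t ∈ Ioi (0 : ℝ), ‖f n t‖ =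
        ((n + M).choose M : ℝ) * (t ^ (M + 1) * Real.exp (-((n + w.re) * t))) := by
      intro t ht
      rw [hf, norm_mul, norm_pow_mul_cexp _ _ (le_of_lt ht), hre]
      simp
    have h2 := integral_pow_mul_cexp (M + 1) (z := ((n + w.re : ℝ) : ℂ))
      (by rw [← hre, Complex.ofReal_re]; exact hpos n)
    have h3 : ∫ t in Ioi (0 : ℝ), t ^ (M + 1) * Real.exp (-((n + w.re) * t)) =
        ((M + 1).factorial : ℝ) / (n + w.re) ^ (M + 2) := by
      apply Complex.ofReal_injective
      rw [← integral_complex_ofReal]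
      push_cast at h2 ⊢
      exact h2
    rw [setIntegral_congr_fun measurableSet_Ioi h1, integral_const_mul, h3, ← hfac,
      Nat.factorial_succ]
    push_cast
    ring
  have key := (hasSum_integral_of_summable_integral_norm hint hsum).tsum_eq
  have h4 : ∫ t in Ioi (0 : ℝ), (toddKernel t : ℂ) ^ (M + 1) * Complex.exp (-(w * t)) =
      ∫ t in Ioi (0 : ℝ), ∑' n, f n t := by
    refine setIntegral_congr_fun measurableSet_Ioi fun t ht => ?_
    have := ((hasSum_toddKernel_pow M ht).mul_right (Complex.exp (-(w * t)))).tsum_eq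
    rw [← this]
    refine tsum_congr fun n => ?_
    rw [hf]
    simp only
    rw [mul_assoc, mul_assoc, ← Complex.exp_add]
    ring_nf
  rw [h4, ← key, risingSeries, ← tsum_mul_left]
  refine tsum_congr fun n => ?_
  rw [hf]
  simp only
  rw [integral_const_mul, integral_pow_mul_cexp _ (hpos n)]
  have := congrArg (fun r : ℝ => (r : ℂ)) (hfac n)
  push_cast at this
  rw [← this, Nat.factorial_succ]
  push_cast
  ring

/-! ### Collapse of the double sum of zeta values. -/

theorem sum_stirlingFirst_mul_pow (M n : ℕ) :
    ∑ m ∈ Finset.range (M + 1), Nat.stirlingFirst (M + 1) (m + 1) * n ^ m =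
      (n + 1).ascFactorial M := by
  induction M with
  | zero => simp [Nat.stirlingFirst_self]
  | succ M ih =>
    -- The range can be lengthened by one because the Stirling number at `(M + 1, M + 2)` is `0`; in
    -- `h2` it is the one at `(M + 1, 0)` that vanishes.
    have h1 : ∑ m ∈ Finset.range (M + 2), Nat.stirlingFirst (M + 1) (m + 1) * n ^ m =
        (n + 1).ascFactorial M := by
      rw [Finset.sum_range_succ, ih, Nat.stirlingFirst_eq_zero_of_lt (by omega)]
      simp
    have h2 : ∑ m ∈ Finset.range (M + 2), Nat.stirlingFirst (M + 1) m * n ^ m =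
        n * (n + 1).ascFactorial M := by
      rw [Finset.sum_range_succ', ← ih, Finset.mul_sum, Nat.stirlingFirst_succ_zero]
      simp only [zero_mul, add_zero]
      exact Finset.sum_congr rfl fun m _ => by ring
    simp_rw [Nat.stirlingFirst_succ_succ (M + 1), add_mul, Finset.sum_add_distrib, mul_assoc,
      ← Finset.mul_sum]
    rw [h1, h2, Nat.ascFactorial_succ]
    ring

theorem natCast_add_ne_zero (n : ℕ) {w : ℂ} (hw : 0 < w.re) : (n : ℂ) + w ≠ 0 := fun h => by
  have h1 : ((n : ℂ) + w).re = n + w.re := by simp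
  rw [h] at h1
  have : (0 : ℝ) ≤ n := Nat.cast_nonneg n
  simp at h1
  linarith

theorem hasSum_hurwitzZeta_natCast {s : ℕ} (hs : 2 ≤ s) {w : ℂ} (hw : 0 < w.re) :
    HasSum (fun n : ℕ => (((n : ℂ) + w)⁻¹) ^ s) (hurwitzZeta s w) := by
  have h := (summable_hurwitzZeta (s := s) (w := w)
    (by rw [Complex.natCast_re]; exact_mod_cast hs) hw).hasSum
  refine h.congr_fun fun n => ?_
  rw [Complex.cpow_natCast, inv_pow, one_div]

/-- After the sums are exchanged and `(n + w)^{-(M+2)}` is factored out, the `j`-sum is the binomial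
expansion of `(w - (n + w))^m = (-n)^m`. All signs then cancel against those of `stirlingS`. -/
theorem sum_choose_mul_stirlingS (M n : ℕ) {w : ℂ} (hw : 0 < w.re) :
    ∑ j ∈ Finset.range (M + 1), ∑ m ∈ Finset.Icc j M,
      (-1 : ℂ) ^ (M + j) * (m.choose j) * (stirlingS (M + 1) (m + 1)) *
        (w ^ (m - j) * ((n : ℂ) + w)⁻¹ ^ (M + 2 - j)) =
      ((n + 1).ascFactorial M : ℂ) / ((n : ℂ) + w) ^ (M + 2) := by
  have hne := natCast_add_ne_zero n hw
  rw [Finset.sum_comm' (s' := fun m => Finset.range (m + 1)) (t' := Finset.range (M + 1))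
    (fun j m => by simp only [Finset.mem_range, Finset.mem_Icc]; omega),
    ← sum_stirlingFirst_mul_pow, Nat.cast_sum, Finset.sum_div]
  refine Finset.sum_congr rfl fun m hm => ?_
  have hm' : m ≤ M := by simpa [Nat.lt_succ_iff] using hm
  have hbin : ∑ j ∈ Finset.range (m + 1), (-((n : ℂ) + w)) ^ j * w ^ (m - j) * (m.choose j) =
      (-(n : ℂ)) ^ m := by
    rw [← add_pow]; congr 1; ring
  have hterm : ∀ j ∈ Finset.range (m + 1), (-1 : ℂ) ^ (M + j) * (m.choose j) *
      (stirlingS (M + 1) (m + 1)) * (w ^ (m - j) * ((n : ℂ) + w)⁻¹ ^ (M + 2 - j)) =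
      ((-1 : ℂ) ^ M * (stirlingS (M + 1) (m + 1)) / ((n : ℂ) + w) ^ (M + 2)) *
        ((-((n : ℂ) + w)) ^ j * w ^ (m - j) * (m.choose j)) := by
    intro j hj
    have hj' : j ≤ M + 2 := by
      have := Finset.mem_range.1 hj
      omega
    rw [inv_pow, show ((n : ℂ) + w) ^ (M + 2) = (n + w) ^ (M + 2 - j) * (n + w) ^ j by
      rw [← pow_add, Nat.sub_add_cancel hj'], neg_pow ((n : ℂ) + w), pow_add]
    field_simp
  rw [Finset.sum_congr rfl hterm, ← Finset.mul_sum, hbin, stirlingS, neg_pow (n : ℂ)]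
  push_cast
  have hsign : (-1 : ℂ) ^ M * (-1) ^ (M + 1 + (m + 1)) * (-1) ^ m = 1 := by
    rw [← pow_add, ← pow_add]
    exact Even.neg_one_pow ⟨M + m + 1, by ring⟩
  rw [div_mul_eq_mul_div]
  congr 1
  linear_combination (Nat.stirlingFirst (M + 1) (m + 1) : ℂ) * (n : ℂ) ^ m * hsign

theorem sum_hurwitzZeta_eq_risingSeries (M : ℕ) {w : ℂ} (hw : 0 < w.re) :
    ∑ j ∈ Finset.range (M + 1), ∑ m ∈ Finset.Icc j M,
      (-1 : ℂ) ^ (M + j) * (m.choose j) * (stirlingS (M + 1) (m + 1)) *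
        (w ^ (m - j) * hurwitzZeta ((M + 2 - j : ℕ) : ℂ) w) = risingSeries M w := by
  have h : HasSum (fun n : ℕ => ∑ j ∈ Finset.range (M + 1), ∑ m ∈ Finset.Icc j M,
      (-1 : ℂ) ^ (M + j) * (m.choose j) * (stirlingS (M + 1) (m + 1)) *
        (w ^ (m - j) * ((n : ℂ) + w)⁻¹ ^ (M + 2 - j)))
      (∑ j ∈ Finset.range (M + 1), ∑ m ∈ Finset.Icc j M,
        (-1 : ℂ) ^ (M + j) * (m.choose j) * (stirlingS (M + 1) (m + 1)) *
          (w ^ (m - j) * hurwitzZeta ((M + 2 - j : ℕ) : ℂ) w)) := by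
    refine hasSum_sum fun j hj => hasSum_sum fun m _ => ?_
    have hj' : 2 ≤ M + 2 - j := by
      have := Finset.mem_range.1 hj
      omega
    exact ((hasSum_hurwitzZeta_natCast hj' hw).mul_left _).mul_left _
  rw [← h.tsum_eq, risingSeries]
  exact tsum_congr fun n => sum_choose_mul_stirlingS M n hw

/-! ### Decay of the Hurwitz zeta function on vertical lines, and integrability. -/

theorem norm_pow_sub_pow_le_of_sub_eq_mul {a b : ℂ} (hab : a - b = a * b) (hle : ‖b‖ ≤ ‖a‖)
    (k : ℕ) : ‖a ^ k - b ^ k‖ ≤ k * ‖a‖ ^ (k + 1) := by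
  induction k with
  | zero => simp
  | succ k ih =>
    have h : a ^ (k + 1) - b ^ (k + 1) = a * (a ^ k - b ^ k) + a * b * b ^ k := by
      rw [← hab]; ring
    rw [h]
    refine (norm_add_le _ _).trans ?_
    rw [norm_mul, norm_mul, norm_mul, norm_pow]
    calc ‖a‖ * ‖a ^ k - b ^ k‖ + ‖a‖ * ‖b‖ * ‖b‖ ^ k
        ≤ ‖a‖ * (k * ‖a‖ ^ (k + 1)) + ‖a‖ * ‖a‖ * ‖a‖ ^ k := by gcongr
      _ = ((k + 1 : ℕ) : ℝ) * ‖a‖ ^ (k + 1 + 1) := by push_cast; ring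

/-- Meant for `a = 1/(n + w)` and `b = 1/(n + 1 + w)`, which satisfy `a - b = ab`: it shows that `p
· a^{p+1}` is a telescoping difference up to an error two orders beyond `a^p`. -/
theorem norm_pow_sub_pow_sub_mul_le {a b : ℂ} (hab : a - b = a * b) (hle : ‖b‖ ≤ ‖a‖)
    (p : ℕ) : ‖a ^ p - b ^ p - p * a ^ (p + 1)‖ ≤ (p : ℝ) ^ 2 * ‖a‖ ^ (p + 2) := by
  induction p with
  | zero => simp
  | succ p ih =>
    have h : a ^ (p + 1) - b ^ (p + 1) - ((p + 1 : ℕ) : ℂ) * a ^ (p + 1 + 1) =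
        a * (a ^ p - b ^ p - p * a ^ (p + 1)) - a * (a ^ (p + 1) - b ^ (p + 1)) := by
      push_cast
      linear_combination b ^ p * hab
    rw [h]
    refine (norm_sub_le _ _).trans ?_
    rw [norm_mul, norm_mul]
    have h2 := norm_pow_sub_pow_le_of_sub_eq_mul hab hle (p + 1)
    calc ‖a‖ * ‖a ^ p - b ^ p - p * a ^ (p + 1)‖ + ‖a‖ * ‖a ^ (p + 1) - b ^ (p + 1)‖
        ≤ ‖a‖ * ((p : ℝ) ^ 2 * ‖a‖ ^ (p + 2)) +
            ‖a‖ * (((p + 1 : ℕ) : ℝ) * ‖a‖ ^ (p + 1 + 1)) := by gcongr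
      _ = ((p : ℝ) ^ 2 + (p + 1)) * ‖a‖ ^ (p + 1 + 2) := by push_cast; ring
      _ ≤ ((p + 1 : ℕ) : ℝ) ^ 2 * ‖a‖ ^ (p + 1 + 2) := by
        gcongr
        push_cast
        have : (0 : ℝ) ≤ p := Nat.cast_nonneg p
        nlinarith

theorem norm_le_norm_natCast_add (n : ℕ) {w : ℂ} (hw : 0 < w.re) : ‖w‖ ≤ ‖(n : ℂ) + w‖ := by
  rw [Complex.norm_def, Complex.norm_def]
  apply Real.sqrt_le_sqrt
  simp only [Complex.normSq_apply, Complex.add_re, Complex.add_im, Complex.natCast_re,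
    Complex.natCast_im, zero_add]
  have : (0 : ℝ) ≤ n := Nat.cast_nonneg n
  nlinarith [mul_nonneg this hw.le]

theorem norm_inv_sq_natCast_add_le (n : ℕ) {w : ℂ} (hw : 0 < w.re) :
    ‖((n : ℂ) + w)⁻¹‖ ^ 2 ≤ 2 / ((n : ℝ) + ‖w‖) ^ 2 := by
  have hn : (0 : ℝ) ≤ n := Nat.cast_nonneg n
  have hw0 : 0 < ‖w‖ := hw.trans_le ((le_abs_self _).trans (Complex.abs_re_le_norm w))
  have h1 : (n : ℝ) ^ 2 + ‖w‖ ^ 2 ≤ ‖(n : ℂ) + w‖ ^ 2 := by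
    rw [← Complex.normSq_eq_norm_sq, ← Complex.normSq_eq_norm_sq]
    simp only [Complex.normSq_apply, Complex.add_re, Complex.add_im, Complex.natCast_re,
      Complex.natCast_im, zero_add]
    nlinarith [mul_nonneg hn hw.le]
  have hz : 0 < ‖(n : ℂ) + w‖ := norm_pos_iff.2 (natCast_add_ne_zero n hw)
  rw [norm_inv, inv_pow, ← one_div, div_le_div_iff₀ (by positivity) (by positivity)]
  nlinarith [sq_nonneg ((n : ℝ) - ‖w‖)]

theorem tendsto_one_div_natCast_add (r : ℝ) :
    Tendsto (fun n : ℕ => 1 / ((n : ℝ) + r)) atTop (𝓝 0) :=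
  (tendsto_atTop_add_const_right atTop r
    (tendsto_natCast_atTop_atTop (R := ℝ))).const_div_atTop 1

theorem hasSum_telescope_inv {r : ℝ} (hr : 0 < r) :
    HasSum (fun n : ℕ => 1 / ((n : ℝ) + r) - 1 / ((n + 1 : ℕ) + r)) (1 / r) := by
  refine (hasSum_iff_tendsto_nat_of_nonneg (fun n => ?_) _).2 ?_
  · rw [sub_nonneg]
    push_cast
    gcongr
    linarith
  · simp_rw [Finset.sum_range_sub' (fun n : ℕ => 1 / ((n : ℝ) + r))]
    simpa using (tendsto_const_nhds (x := 1 / r)).sub (tendsto_one_div_natCast_add r)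

theorem one_div_sq_le_telescope {a r : ℝ} (ha : 0 < a) (har : a ≤ r) (n : ℕ) :
    1 / ((n : ℝ) + r) ^ 2 ≤
      (1 + 1 / a) * (1 / ((n : ℝ) + r) - 1 / ((n + 1 : ℕ) + r)) := by
  have hn : (0 : ℝ) ≤ n := Nat.cast_nonneg n
  have hr : 0 < r := ha.trans_le har
  have h1 : 0 < (n : ℝ) + r := by positivity
  have h2 : 1 / ((n : ℝ) + r) - 1 / ((n + 1 : ℕ) + r) =
      1 / (((n : ℝ) + r) * (n + r + 1)) := by
    push_cast
    have : (n : ℝ) + 1 + r ≠ 0 := by positivity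
    have : (n : ℝ) + r + 1 ≠ 0 := by positivity
    field_simp
    ring
  rw [h2, mul_one_div, div_le_div_iff₀ (by positivity) (by positivity)]
  have h3 : (n : ℝ) + r + 1 ≤ (1 + 1 / a) * (n + r) := by
    have : 1 ≤ 1 / a * (n + r) := by
      rw [one_div_mul_eq_div, one_le_div ha]; linarith
    linarith
  nlinarith

/-- Leading asymptotics of the Hurwitz zeta function at integers `p + 1 ≥ 2`, uniformly in the
half-plane `Re w ≥ a`. -/
theorem norm_hurwitzZeta_sub_le {p : ℕ} (hp : 1 ≤ p) {a : ℝ} (ha : 0 < a) {w : ℂ}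
    (hw : a ≤ w.re) :
    ‖hurwitzZeta ((p + 1 : ℕ) : ℂ) w - w⁻¹ ^ p / p‖ ≤ 2 * p * (1 + 1 / a) * ‖w⁻¹‖ ^ (p + 1) := by
  have hwre : 0 < w.re := ha.trans_le hw
  have hwa : a ≤ ‖w‖ := hw.trans ((le_abs_self _).trans (Complex.abs_re_le_norm w))
  have hw0 : 0 < ‖w‖ := ha.trans_le hwa
  have hp0 : (0 : ℝ) < p := by exact_mod_cast hp
  have hpc : (p : ℂ) ≠ 0 := by exact_mod_cast hp0.ne'
  set A : ℕ → ℂ := fun n => ((n : ℂ) + w)⁻¹ with hA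
  have hAsucc : ∀ n, A n - A (n + 1) = A n * A (n + 1) := by
    intro n
    have h1 := natCast_add_ne_zero n hwre
    have h2 := natCast_add_ne_zero (n + 1) hwre
    simp only [hA]
    push_cast at h2 ⊢
    field_simp
    ring
  have hAle : ∀ n, ‖A (n + 1)‖ ≤ ‖A n‖ := by
    intro n
    have h1 : 0 < ‖(n : ℂ) + w‖ := norm_pos_iff.2 (natCast_add_ne_zero n hwre)
    have h2 := norm_le_norm_natCast_add 1 (w := (n : ℂ) + w) (by simp; positivity)
    simp only [hA, norm_inv]
    push_cast at h2 ⊢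
    rw [show (n : ℂ) + 1 + w = 1 + (n + w) by ring]
    gcongr
  have hAw : ∀ n, ‖A n‖ ≤ ‖w⁻¹‖ := by
    intro n
    simp only [hA, norm_inv]
    have := norm_le_norm_natCast_add n hwre
    gcongr
  -- Each zeta term is compared with a difference that telescopes to `w^{-p}/p`. In the error, `|A
  -- n|^p` is bounded by `|w|^{-p}`, and the remaining `|A n|²` by a telescoping majorant with sum
  -- of order `1/|w|`.
  have hterm : ∀ n, ‖A n ^ (p + 1) - (A n ^ p - A (n + 1) ^ p) / p‖ ≤
      2 * p * (1 + 1 / a) * ‖w⁻¹‖ ^ p *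
        (1 / ((n : ℝ) + ‖w‖) - 1 / ((n + 1 : ℕ) + ‖w‖)) := by
    intro n
    have h1 := norm_pow_sub_pow_sub_mul_le (hAsucc n) (hAle n) p
    have h2 : A n ^ (p + 1) - (A n ^ p - A (n + 1) ^ p) / p =
        -(A n ^ p - A (n + 1) ^ p - p * A n ^ (p + 1)) / p := by
      field_simp
      ring
    rw [h2, norm_div, norm_neg, Complex.norm_natCast, div_le_iff₀ hp0]
    calc ‖A n ^ p - A (n + 1) ^ p - p * A n ^ (p + 1)‖
        ≤ (p : ℝ) ^ 2 * ‖A n‖ ^ (p + 2) := h1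
      _ = (p : ℝ) ^ 2 * (‖A n‖ ^ p * ‖A n‖ ^ 2) := by rw [pow_add]
      _ ≤ (p : ℝ) ^ 2 * (‖w⁻¹‖ ^ p * (2 * ((1 + 1 / a) *
          (1 / ((n : ℝ) + ‖w‖) - 1 / ((n + 1 : ℕ) + ‖w‖))))) := by
        have h3 := norm_inv_sq_natCast_add_le n hwre
        have h4 := one_div_sq_le_telescope ha hwa n
        have h5 : ‖A n‖ ^ 2 ≤ 2 * ((1 + 1 / a) *
          (1 / ((n : ℝ) + ‖w‖) - 1 / ((n + 1 : ℕ) + ‖w‖))) := by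
          refine h3.trans ?_
          rw [div_eq_mul_one_div]
          linarith
        have h6 := hAw n
        gcongr
      _ = _ := by ring
  have hbound := (hasSum_telescope_inv hw0).mul_left (2 * p * (1 + 1 / a) * ‖w⁻¹‖ ^ p)
  have hz := hasSum_hurwitzZeta_natCast (s := p + 1) (by omega) hwre
  have hdsum : Summable fun n => A n ^ (p + 1) - (A n ^ p - A (n + 1) ^ p) / p :=
    Summable.of_norm_bounded hbound.summable hterm
  have hlimA : Tendsto (fun n => A n ^ p) atTop (𝓝 0) := by
    rw [tendsto_zero_iff_norm_tendsto_zero]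
    have hA1 : Tendsto (fun n => ‖A n‖) atTop (𝓝 0) := by
      refine squeeze_zero (fun n => norm_nonneg _) (fun n => ?_)
        (tendsto_one_div_natCast_add w.re)
      have hn : 0 < (n : ℝ) + w.re := by positivity
      have : (n : ℝ) + w.re ≤ ‖(n : ℂ) + w‖ := by
        simpa using (le_abs_self _).trans (Complex.abs_re_le_norm ((n : ℂ) + w))
      simp only [hA, norm_inv]
      rw [one_div]
      gcongr
    simpa [norm_pow, zero_pow (by omega : p ≠ 0)] using hA1.pow p
  have htel : HasSum (fun n => (A n ^ p - A (n + 1) ^ p) / p) (w⁻¹ ^ p / p) := by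
    have hs : Summable fun n => (A n ^ p - A (n + 1) ^ p) / p := by
      refine (hz.summable.sub hdsum).congr fun n => ?_
      simp only [hA]
      ring
    refine (hs.hasSum_iff_tendsto_nat).2 ?_
    simp_rw [← Finset.sum_div, Finset.sum_range_sub' (fun n => A n ^ p)]
    have := ((tendsto_const_nhds (x := A 0 ^ p)).sub hlimA).div_const (p : ℂ)
    simpa [hA] using this
  have hdiff := hz.sub htel
  rw [← hdiff.tsum_eq]
  refine (tsum_of_norm_bounded hbound hterm).trans (le_of_eq ?_)
  rw [norm_inv]
  ring

/-- With `s = k + 2 + d`, the product is `w^{-(d+1)}/p` plus an error of order `|w|^{-(d+2)}`. For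
`d = 0` the modulus is not integrable on the line, so the real part is essential. -/
theorem abs_re_pow_mul_hurwitzZeta_le {a : ℝ} (ha : 0 < a) {k s : ℕ} (hks : k + 2 ≤ s) :
    ∃ C : ℝ, ∀ w : ℂ, w.re = a → |(w ^ k * hurwitzZeta (s : ℂ) w).re| ≤ C * ‖w⁻¹‖ ^ 2 := by
  obtain ⟨d, rfl⟩ := Nat.exists_eq_add_of_le hks
  set p := k + 1 + d with hp
  have hp0 : (0 : ℝ) < p := by rw [hp]; positivity
  refine ⟨2 * p * (1 + 1 / a) * (1 / a) ^ d + (1 + a) * (1 + 1 / a) ^ d / p, fun w hw => ?_⟩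
  have hwa : a ≤ ‖w‖ := hw.symm.le.trans ((le_abs_self _).trans (Complex.abs_re_le_norm w))
  have hw0 : 0 < ‖w‖ := ha.trans_le hwa
  have hwc : w ≠ 0 := norm_pos_iff.1 hw0
  have hinv : ‖w⁻¹‖ ≤ 1 / a := by
    rw [norm_inv, one_div]; gcongr
  have h1 := norm_hurwitzZeta_sub_le (p := p) (by omega) ha (w := w) hw.symm.le
  rw [show k + 2 + d = p + 1 by omega]
  have hsplit : w ^ k * hurwitzZeta ((p + 1 : ℕ) : ℂ) w =
      w ^ k * (hurwitzZeta ((p + 1 : ℕ) : ℂ) w - w⁻¹ ^ p / p) + w⁻¹ ^ (d + 1) / p := by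
    have : w ^ k * w⁻¹ ^ p = w⁻¹ ^ (d + 1) := by
      rw [hp, show k + 1 + d = k + (d + 1) by ring, pow_add, ← mul_assoc, ← mul_pow,
        mul_inv_cancel₀ hwc]
      simp
    rw [← this]
    ring
  rw [hsplit, Complex.add_re, add_mul]
  refine (abs_add_le _ _).trans (add_le_add ?_ ?_)
  · refine (Complex.abs_re_le_norm _).trans ?_
    rw [norm_mul]
    calc ‖w ^ k‖ * ‖hurwitzZeta ((p + 1 : ℕ) : ℂ) w - w⁻¹ ^ p / p‖
        ≤ ‖w ^ k‖ * (2 * p * (1 + 1 / a) * ‖w⁻¹‖ ^ (p + 1)) := by gcongr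
      _ = 2 * p * (1 + 1 / a) * ((‖w‖ ^ k * ‖w⁻¹‖ ^ k) * ‖w⁻¹‖ ^ d * ‖w⁻¹‖ ^ 2) := by
        rw [norm_pow, hp]; ring
      _ = 2 * p * (1 + 1 / a) * (‖w⁻¹‖ ^ d * ‖w⁻¹‖ ^ 2) := by
        rw [← mul_pow, norm_inv, mul_inv_cancel₀ hw0.ne']; simp
      _ ≤ 2 * p * (1 + 1 / a) * ((1 / a) ^ d * ‖w⁻¹‖ ^ 2) := by gcongr
      _ = _ := by ring
  · have h2 : (w⁻¹ ^ (d + 1) / p).re = (w⁻¹ ^ (d + 1)).re / p := Complex.div_natCast_re _ _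
    rw [h2, abs_div, Nat.abs_cast, div_mul_eq_mul_div]
    gcongr
    rcases d with _ | d
    -- The critical case: `1/w` decays only to first order, but its real part gains another factor
    -- `1/|w|`.
    · have : (w⁻¹ ^ (0 + 1)).re = a * ‖w⁻¹‖ ^ 2 := by
        rw [zero_add, pow_one, Complex.inv_re, hw, Complex.normSq_eq_norm_sq, norm_inv, inv_pow]
        rfl
      rw [this, abs_of_nonneg (by positivity), pow_zero, mul_one]
      gcongr
      linarith
    · refine (Complex.abs_re_le_norm _).trans ?_
      rw [norm_pow, show d + 1 + 1 = d + 2 by ring, pow_add]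
      have : ‖w⁻¹‖ ^ d ≤ (1 + a) * (1 + 1 / a) ^ (d + 1) := by
        calc ‖w⁻¹‖ ^ d ≤ (1 + 1 / a) ^ d := by gcongr; linarith
          _ ≤ (1 + 1 / a) ^ (d + 1) := by
            apply pow_le_pow_right₀ _ (by omega)
            have : 0 < 1 / a := by positivity
            linarith
          _ ≤ (1 + a) * (1 + 1 / a) ^ (d + 1) :=
            le_mul_of_one_le_left (by positivity) (by linarith)
      gcongr

theorem continuous_hurwitzZeta_vertical {a : ℝ} (ha : 0 < a) {s : ℕ} (hs : 2 ≤ s) :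
    Continuous fun u : ℝ => hurwitzZeta (s : ℂ) ((a : ℂ) + Complex.I * u) := by
  have hre : ∀ u : ℝ, ((a : ℂ) + Complex.I * u).re = a := fun u => by simp
  have h1 : (fun u : ℝ => hurwitzZeta (s : ℂ) ((a : ℂ) + Complex.I * u)) =
      fun u : ℝ => ∑' n : ℕ, ((n : ℂ) + ((a : ℂ) + Complex.I * u))⁻¹ ^ s := by
    funext u
    exact (hasSum_hurwitzZeta_natCast hs (by rw [hre]; exact ha)).tsum_eq.symm
  rw [h1]
  have hb := (Real.summable_one_div_nat_add_rpow a s).2 (by exact_mod_cast hs)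
  refine continuous_tsum (fun n => ?_) hb fun n u => ?_
  · refine Continuous.pow (Continuous.inv₀ (by fun_prop) fun u => ?_) s
    exact natCast_add_ne_zero n (by rw [hre]; exact ha)
  · have hn : 0 < (n : ℝ) + a := by positivity
    rw [norm_pow, norm_inv, abs_of_pos hn, Real.rpow_natCast, inv_pow, one_div]
    have : (n : ℝ) + a ≤ ‖(n : ℂ) + ((a : ℂ) + Complex.I * u)‖ := by
      simpa using (le_abs_self _).trans
        (Complex.abs_re_le_norm ((n : ℂ) + ((a : ℂ) + Complex.I * u)))
    gcongr

theorem norm_inv_vertical_sq_le {a : ℝ} (ha : 0 < a) (u : ℝ) :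
    ‖((a : ℂ) + Complex.I * u)⁻¹‖ ^ 2 ≤ (1 + 1 / a ^ 2) * (1 + u ^ 2)⁻¹ := by
  have hy : 0 < 1 + u ^ 2 := by positivity
  rw [norm_inv, inv_pow, ← Complex.normSq_eq_norm_sq]
  simp only [Complex.normSq_apply, Complex.add_re, Complex.add_im, Complex.ofReal_re,
    Complex.ofReal_im, Complex.mul_re, Complex.mul_im, Complex.I_re, Complex.I_im]
  rw [← one_div, ← div_eq_mul_inv, div_le_div_iff₀ (by nlinarith [sq_nonneg u]) hy]
  have : (1 + 1 / a ^ 2) * (a ^ 2 + u ^ 2) = 1 + u ^ 2 + (a ^ 2 + u ^ 2 / a ^ 2) := by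
    field_simp; ring
  have h0 : 0 ≤ a ^ 2 + u ^ 2 / a ^ 2 := by positivity
  nlinarith

theorem nonneg_of_abs_le_mul_inv_sq {f : ℝ → ℝ} {a C : ℝ} (ha : 0 < a)
    (hb : ∀ u : ℝ, |f u| ≤ C * ‖((a : ℂ) + Complex.I * u)⁻¹‖ ^ 2) : 0 ≤ C := by
  have h := (abs_nonneg _).trans (hb 0)
  have : 0 < ‖((a : ℂ) + Complex.I * (0 : ℝ))⁻¹‖ ^ 2 := by simp; positivity
  exact nonneg_of_mul_nonneg_left h this

theorem integrable_of_abs_le_mul_inv_sq {f : ℝ → ℝ} (hf : Continuous f) {a C : ℝ} (ha : 0 < a)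
    (hb : ∀ u : ℝ, |f u| ≤ C * ‖((a : ℂ) + Complex.I * u)⁻¹‖ ^ 2) : Integrable f := by
  refine (integrable_inv_one_add_sq.const_mul (C * (1 + 1 / a ^ 2))).mono'
    hf.aestronglyMeasurable (Eventually.of_forall fun u => ?_)
  rw [mul_assoc]
  exact (hb u).trans (mul_le_mul_of_nonneg_left (norm_inv_vertical_sq_le ha u)
    (nonneg_of_abs_le_mul_inv_sq ha hb))

theorem integrable_of_abs_le_inv_sq {f : ℝ → ℝ} (hf : Continuous f) {a C c : ℝ} (ha : 0 < a)
    (hc : 0 < c) (hb : ∀ u : ℝ, |f u| ≤ C * ‖((a : ℂ) + Complex.I * u)⁻¹‖ ^ 2) :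
    Integrable fun u => f u * Real.log (1 + u ^ 2 / c ^ 2) := by
  have hC := nonneg_of_abs_le_mul_inv_sq ha hb
  have hJ : Integrable fun u : ℝ => (1 + ‖u‖ ^ 2) ^ (-(3 / 2 : ℝ) / 2) :=
    integrable_rpow_neg_one_add_norm_sq (by norm_num)
  set K := 1 + 1 / c ^ 2 with hK
  set L := 1 + 1 / a ^ 2 with hL
  have hKpos : 0 < K := by positivity
  have hlogc : Continuous fun u : ℝ => Real.log (1 + u ^ 2 / c ^ 2) := by
    refine Continuous.log (by fun_prop) fun u => ?_
    positivity
  refine (hJ.const_mul (C * L * (K ^ (1 / 4 : ℝ) * 4))).mono' (by fun_prop)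
    (Eventually.of_forall fun u => ?_)
  have hy : 0 < 1 + u ^ 2 := by positivity
  have h1 : |f u| ≤ C * (L * (1 + u ^ 2)⁻¹) :=
    (hb u).trans (mul_le_mul_of_nonneg_left (norm_inv_vertical_sq_le ha u) hC)
  -- Any exponent in `(0, 1/2)` would serve; `1/4` leaves decay `|u|^{-3/2}`.
  have h2 : Real.log (1 + u ^ 2 / c ^ 2) ≤ K ^ (1 / 4 : ℝ) * 4 * (1 + u ^ 2) ^ (1 / 4 : ℝ) := by
    have hle : 1 + u ^ 2 / c ^ 2 ≤ K * (1 + u ^ 2) := by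
      have : K * (1 + u ^ 2) = 1 + u ^ 2 / c ^ 2 + (u ^ 2 + 1 / c ^ 2) := by rw [hK]; ring
      rw [this]
      have : 0 ≤ u ^ 2 + 1 / c ^ 2 := by positivity
      linarith
    refine (Real.log_le_log (by positivity) hle).trans ?_
    refine (Real.log_le_rpow_div (by positivity) (by norm_num : (0 : ℝ) < 1 / 4)).trans ?_
    rw [Real.mul_rpow hKpos.le hy.le]
    apply le_of_eq
    ring
  have h3 : 0 ≤ Real.log (1 + u ^ 2 / c ^ 2) := Real.log_nonneg (by
    have : 0 ≤ u ^ 2 / c ^ 2 := by positivity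
    linarith)
  rw [norm_mul, Real.norm_eq_abs, Real.norm_of_nonneg h3, Real.norm_eq_abs, sq_abs]
  have h4 : (1 + u ^ 2)⁻¹ * (1 + u ^ 2) ^ (1 / 4 : ℝ) = (1 + u ^ 2) ^ (-(3 / 2 : ℝ) / 2) := by
    rw [← Real.rpow_neg_one, ← Real.rpow_add hy]
    norm_num
  calc |f u| * Real.log (1 + u ^ 2 / c ^ 2)
      ≤ C * (L * (1 + u ^ 2)⁻¹) * (K ^ (1 / 4 : ℝ) * 4 * (1 + u ^ 2) ^ (1 / 4 : ℝ)) := by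
        gcongr
    _ = C * L * (K ^ (1 / 4 : ℝ) * 4) * ((1 + u ^ 2)⁻¹ * (1 + u ^ 2) ^ (1 / 4 : ℝ)) := by ring
    _ = _ := by rw [h4]

theorem integrable_integrand {a c : ℝ} (ha : 0 < a) (hc : 0 < c) {k s : ℕ} (hks : k + 2 ≤ s) :
    Integrable (integrand a k s c) := by
  obtain ⟨C, hC⟩ := abs_re_pow_mul_hurwitzZeta_le ha hks
  have h1 := continuous_hurwitzZeta_vertical ha (by omega : 2 ≤ s)
  exact integrable_of_abs_le_inv_sq (f := fun u : ℝ => (((a : ℂ) + Complex.I * u) ^ k *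
    hurwitzZeta s ((a : ℂ) + Complex.I * u)).re) (by fun_prop) ha hc
    fun u => hC _ (by simp)

/-! ### Cosine inversion and pairing with the logarithm. -/

theorem integral_cexp_mul_even {φ : ℝ → ℝ} (hφ : Integrable φ) (heven : ∀ t, φ (-t) = φ t)
    (θ : ℝ) : ∫ t : ℝ, Complex.exp ((θ * t : ℝ) * Complex.I) * (φ t : ℂ) =
      ((∫ t : ℝ, Real.cos (θ * t) * φ t : ℝ) : ℂ) := by
  have hc : Integrable fun t => Real.cos (θ * t) * φ t :=
    hφ.bdd_mul (c := 1) (by fun_prop) (Eventually.of_forall fun t => Real.abs_cos_le_one _)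
  have hs : Integrable fun t => Real.sin (θ * t) * φ t :=
    hφ.bdd_mul (c := 1) (by fun_prop) (Eventually.of_forall fun t => Real.abs_sin_le_one _)
  have hodd : ∫ t : ℝ, Real.sin (θ * t) * φ t = 0 := by
    have h := integral_neg_eq_self (fun t : ℝ => Real.sin (θ * t) * φ t) volume
    simp only [heven, mul_neg, Real.sin_neg, neg_mul, integral_neg] at h
    linarith
  have hsplit : ∀ t : ℝ, Complex.exp ((θ * t : ℝ) * Complex.I) * (φ t : ℂ) =
      ((Real.cos (θ * t) * φ t : ℝ) : ℂ) + Complex.I * ((Real.sin (θ * t) * φ t : ℝ) : ℂ) := by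
    intro t
    rw [Complex.exp_mul_I]
    push_cast
    ring
  have hc' : Integrable fun t => ((Real.cos (θ * t) * φ t : ℝ) : ℂ) := hc.ofReal
  have hs' : Integrable fun t => ((Real.sin (θ * t) * φ t : ℝ) : ℂ) := hs.ofReal
  simp_rw [hsplit]
  rw [integral_add hc' (hs'.const_mul Complex.I), integral_const_mul,
    integral_complex_ofReal, integral_complex_ofReal, hodd]
  simp

theorem integrable_comp_abs {g : ℝ → ℝ} (hg : IntegrableOn g (Ioi 0)) :
    Integrable fun t => g |t| := by
  have h1 : IntegrableOn (fun t => g |t|) (Ioi 0) :=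
    hg.congr_fun (fun t ht => by simp only [abs_of_pos (show (0 : ℝ) < t from ht)])
      measurableSet_Ioi
  have h2 : IntegrableOn (fun t => g |t|) (Iic 0) := by
    have h3 : IntegrableOn (fun t => g |t|) (Ioi (-0)) := by simpa using h1
    have h4 := h3.comp_neg_Iio
    simp only [abs_neg] at h4
    rw [integrableOn_Iic_iff_integrableOn_Iio]
    exact h4
  rw [← integrableOn_univ, ← Iic_union_Ioi (a := (0 : ℝ))]
  exact h2.union h1

/-- The half-line cosine transform. -/
noncomputable def cosTransform (g : ℝ → ℝ) (u : ℝ) : ℝ :=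
  ∫ t in Ioi (0 : ℝ), g t * Real.cos (u * t)

theorem cosTransform_neg (g : ℝ → ℝ) (u : ℝ) : cosTransform g (-u) = cosTransform g u := by
  simp [cosTransform]

/-- Inversion of the half-line cosine transform. -/
theorem integral_cosTransform_mul_cos {g : ℝ → ℝ} (hg : Continuous g)
    (hgi : IntegrableOn g (Ioi 0)) (hR : Integrable (cosTransform g)) {t : ℝ} (ht : 0 ≤ t) :
    ∫ u : ℝ, cosTransform g u * Real.cos (u * t) = Real.pi * g t := by
  have hpi : (0 : ℝ) < 2 * Real.pi := by positivity
  have hφi := integrable_comp_abs hgi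
  -- Extend `g` evenly to the line: its Fourier transform is twice the cosine transform at frequency
  -- `2πv`, and ordinary Fourier inversion applies.
  have hfour : 𝓕 (fun t : ℝ => ((g |t| : ℝ) : ℂ)) =
      fun v : ℝ => ((2 * cosTransform g (2 * Real.pi * v) : ℝ) : ℂ) := by
    funext v
    rw [Real.fourier_real_eq_integral_exp_smul]
    have h := integral_cexp_mul_even hφi (fun t => by simp) (-2 * Real.pi * v)
    simp only [smul_eq_mul]
    have h1 : ∀ t : ℝ, -2 * Real.pi * t * v = -2 * Real.pi * v * t := fun t => by ring
    simp_rw [h1]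
    rw [h]
    congr 1
    have h2 : ∀ t : ℝ, Real.cos (-2 * Real.pi * v * t) * g |t| =
        (fun y => g y * Real.cos (2 * Real.pi * v * y)) |t| := by
      intro t
      have h3 : Real.cos (2 * Real.pi * v * |t|) = Real.cos (-2 * Real.pi * v * t) := by
        rcases abs_cases t with ⟨h, _⟩ | ⟨h, _⟩
        · rw [h, ← Real.cos_neg]; ring_nf
        · rw [h]; ring_nf
      simp only [h3]
      ring
    simp_rw [h2]
    rw [integral_comp_abs (f := fun y => g y * Real.cos (2 * Real.pi * v * y))]
    rfl
  have hRs : Integrable fun v : ℝ => 2 * cosTransform g (2 * Real.pi * v) :=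
    (hR.comp_mul_left' hpi.ne').const_mul 2
  have hinv := Continuous.fourierInv_fourier_eq
    (f := fun t : ℝ => ((g |t| : ℝ) : ℂ)) (by fun_prop) hφi.ofReal
    (by rw [hfour]; exact hRs.ofReal)
  have hinv_t := congrFun hinv t
  rw [hfour, Real.fourierInv_eq'] at hinv_t
  have h := integral_cexp_mul_even hRs (fun v => by
    rw [mul_neg, cosTransform_neg]) (2 * Real.pi * t)
  have h1 : ∀ v : ℝ, 2 * Real.pi * inner ℝ v t = 2 * Real.pi * t * v := fun v => by
    simp; ring
  simp only [smul_eq_mul] at hinv_t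
  simp_rw [h1] at hinv_t
  rw [h, abs_of_nonneg ht] at hinv_t
  have h2 : ∫ v : ℝ, Real.cos (2 * Real.pi * t * v) * (2 * cosTransform g (2 * Real.pi * v)) =
      g t := by exact_mod_cast hinv_t
  have h3 := Measure.integral_comp_mul_left
    (fun u : ℝ => cosTransform g u * Real.cos (u * t)) (2 * Real.pi)
  rw [abs_of_pos (inv_pos.2 hpi), smul_eq_mul] at h3
  have h4 : ∫ v : ℝ, Real.cos (2 * Real.pi * t * v) * (2 * cosTransform g (2 * Real.pi * v)) =
      2 * ∫ v : ℝ, cosTransform g (2 * Real.pi * v) * Real.cos (2 * Real.pi * v * t) := by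
    rw [← integral_const_mul]
    refine integral_congr_ae (Eventually.of_forall fun v => ?_)
    simp only
    rw [show 2 * Real.pi * t * v = 2 * Real.pi * v * t by ring]
    ring
  rw [h4, h3] at h2
  field_simp at h2
  linarith

theorem abs_one_sub_cos_mul_exp_div_le (c u : ℝ) {t : ℝ} (ht : 0 < t) :
    |(1 - Real.cos (u * t)) * Real.exp (-(c * t)) / t| ≤ |u| * Real.exp (-(c * t)) := by
  have h := Real.abs_cos_sub_cos_le 0 (u * t)
  rw [Real.cos_zero, zero_sub, abs_neg, abs_mul, abs_of_pos ht] at h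
  rw [abs_div, abs_mul, abs_of_pos ht, abs_of_pos (Real.exp_pos _), div_le_iff₀ ht]
  nlinarith [mul_le_mul_of_nonneg_right h (Real.exp_pos (-(c * t))).le]

theorem integrableOn_one_sub_cos_mul_exp_div {c : ℝ} (hc : 0 < c) (u : ℝ) :
    IntegrableOn (fun t => (1 - Real.cos (u * t)) * Real.exp (-(c * t)) / t) (Ioi 0) := by
  have h0 := (integrableOn_pow_mul_exp 0 hc).const_mul |u|
  simp only [pow_zero, one_mul] at h0
  refine Integrable.mono' h0 (Measurable.aestronglyMeasurable (by fun_prop)) ?_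
  filter_upwards [ae_restrict_mem measurableSet_Ioi] with t ht
  exact abs_one_sub_cos_mul_exp_div_le c u ht

/-- Imaginary part of `∫ e^{-zt} dt = 1/z` at `z = c - iu`. -/
theorem integral_sin_mul_exp {c : ℝ} (hc : 0 < c) (u : ℝ) :
    ∫ t in Ioi (0 : ℝ), Real.sin (u * t) * Real.exp (-(c * t)) = u / (c ^ 2 + u ^ 2) := by
  set z : ℂ := (c : ℂ) - Complex.I * u with hz
  have hre : 0 < z.re := by simpa [hz] using hc
  have h1 := integral_pow_mul_cexp 0 hre
  have h2 := integrableOn_pow_mul_cexp 0 hre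
  simp only [pow_zero, one_mul, zero_add, pow_one, Nat.factorial_zero, Nat.cast_one] at h1 h2
  have h3 := congrArg Complex.im h1
  rw [← RCLike.im_to_complex, ← integral_im h2] at h3
  rw [one_div, Complex.inv_im] at h3
  have h4 : -z.im / Complex.normSq z = u / (c ^ 2 + u ^ 2) := by
    simp [hz, Complex.normSq_apply, sq]
  rw [← h4, ← h3]
  refine integral_congr_ae (Eventually.of_forall fun t => ?_)
  simp only [RCLike.im_to_complex, Complex.exp_im]
  have h5 : (-(z * t)).re = -(c * t) := by simp [hz]
  have h6 : (-(z * t)).im = u * t := by simp [hz]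
  rw [h5, h6, mul_comm]

/-- Both sides vanish at `u = 0` and have derivative `u / (c² + u²)` in `u`. -/
theorem integral_one_sub_cos_mul_exp_div {c : ℝ} (hc : 0 < c) (u : ℝ) :
    ∫ t in Ioi (0 : ℝ), (1 - Real.cos (u * t)) * Real.exp (-(c * t)) / t =
      1 / 2 * Real.log (1 + u ^ 2 / c ^ 2) := by
  set G : ℝ → ℝ := fun u =>
    ∫ t in Ioi (0 : ℝ), (1 - Real.cos (u * t)) * Real.exp (-(c * t)) / t with hG
  have hGd : ∀ u, HasDerivAt G (u / (c ^ 2 + u ^ 2)) u := by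
    intro u
    rw [← integral_sin_mul_exp hc u]
    have h0 := integrableOn_pow_mul_exp 0 hc
    simp only [pow_zero, one_mul] at h0
    refine (hasDerivAt_integral_of_dominated_loc_of_deriv_le
      (F := fun u t => (1 - Real.cos (u * t)) * Real.exp (-(c * t)) / t)
      (F' := fun u t => Real.sin (u * t) * Real.exp (-(c * t))) (x₀ := u)
      (s := univ) univ_mem
      (Eventually.of_forall fun y => Measurable.aestronglyMeasurable (by fun_prop))
      (integrableOn_one_sub_cos_mul_exp_div hc u) (by fun_prop) ?_ h0 ?_).2
    · refine Eventually.of_forall fun t y _ => ?_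
      rw [norm_mul, Real.norm_of_nonneg (Real.exp_pos _).le]
      exact mul_le_of_le_one_left (Real.exp_pos _).le (Real.abs_sin_le_one _)
    · filter_upwards [ae_restrict_mem measurableSet_Ioi] with t ht y _
      have ht' : t ≠ 0 := ne_of_gt ht
      have h1 : HasDerivAt (fun y => Real.cos (y * t)) (-Real.sin (y * t) * (1 * t)) y :=
        ((hasDerivAt_id y).mul_const t).cos
      refine (((h1.const_sub 1).mul_const (Real.exp (-(c * t)))).div_const t).congr_deriv ?_
      field_simp
  have hLd : ∀ u, HasDerivAt (fun u => 1 / 2 * Real.log (1 + u ^ 2 / c ^ 2))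
      (u / (c ^ 2 + u ^ 2)) u := by
    intro u
    have hpos : 0 < 1 + u ^ 2 / c ^ 2 := by positivity
    refine (((((hasDerivAt_id u).pow 2).div_const (c ^ 2)).const_add 1).log
      hpos.ne' |>.const_mul (1 / 2)).congr_deriv ?_
    have : 0 < c ^ 2 + u ^ 2 := by positivity
    simp only [id, Pi.pow_apply]
    field_simp
    norm_num
  have hd : ∀ v, HasDerivAt (fun u => G u - 1 / 2 * Real.log (1 + u ^ 2 / c ^ 2)) 0 v := fun v =>
    ((hGd v).sub (hLd v)).congr_deriv (sub_self _)
  have := is_const_of_deriv_eq_zero (fun v => (hd v).differentiableAt) (fun v => (hd v).deriv) u 0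
  have hG0 : G 0 = 0 := by simp [hG]
  simp only [hG0] at this
  norm_num at this
  simp only [hG] at this
  linarith

/-- Parseval-type evaluation: integrating a cosine transform against `log (1 + u² / c²)`. -/
theorem integral_cosTransform_mul_log {g : ℝ → ℝ} (hg : Continuous g)
    (hgi : IntegrableOn g (Ioi 0)) (hRc : Continuous (cosTransform g))
    (hR : Integrable (cosTransform g)) {c : ℝ} (hc : 0 < c)
    (hRlog : Integrable fun u => cosTransform g u * Real.log (1 + u ^ 2 / c ^ 2)) :
    ∫ u : ℝ, cosTransform g u * Real.log (1 + u ^ 2 / c ^ 2) =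
      2 * Real.pi * ∫ t in Ioi (0 : ℝ), (g 0 - g t) * Real.exp (-(c * t)) / t := by
  set f : ℝ → ℝ → ℝ := fun u t =>
    cosTransform g u * ((1 - Real.cos (u * t)) * Real.exp (-(c * t)) / t) with hf
  have hnn : ∀ u t : ℝ, 0 < t → 0 ≤ (1 - Real.cos (u * t)) * Real.exp (-(c * t)) / t := by
    intro u t ht
    have := Real.cos_le_one (u * t)
    have h1 : 0 ≤ 1 - Real.cos (u * t) := by linarith
    positivity
  have hmeas : Measurable (Function.uncurry f) := by
    have := hRc.measurable
    simp only [hf, Function.uncurry_def]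
    fun_prop
  -- As `1 - cos ≥ 0`, integrating `|f|` over `t` gives exactly half of `|R(u)| log (1 + u²/c²)`,
  -- `R` being the transform; Fubini thus needs only `hRlog`.
  have hfi : Integrable (Function.uncurry f) (volume.prod (volume.restrict (Ioi 0))) := by
    rw [integrable_prod_iff hmeas.aestronglyMeasurable]
    refine ⟨Eventually.of_forall fun u =>
      (integrableOn_one_sub_cos_mul_exp_div hc u).const_mul (cosTransform g u), ?_⟩
    refine (hRlog.norm.const_mul (1 / 2)).congr (Eventually.of_forall fun u => ?_)
    have h1 : ∫ t in Ioi (0 : ℝ), ‖Function.uncurry f (u, t)‖ =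
        ∫ t in Ioi (0 : ℝ), |cosTransform g u| *
          ((1 - Real.cos (u * t)) * Real.exp (-(c * t)) / t) := by
      refine setIntegral_congr_fun measurableSet_Ioi fun t ht => ?_
      simp only [Function.uncurry_apply_pair, hf, norm_mul, Real.norm_eq_abs]
      have := abs_of_nonneg (hnn u t ht)
      rw [← abs_mul, abs_mul, this]
    have h2 : 0 ≤ Real.log (1 + u ^ 2 / c ^ 2) := Real.log_nonneg (by
      have : 0 ≤ u ^ 2 / c ^ 2 := by positivity
      linarith)
    simp only
    rw [h1, integral_const_mul, integral_one_sub_cos_mul_exp_div hc, norm_mul,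
      Real.norm_of_nonneg h2, Real.norm_eq_abs]
    ring
  have hswap := integral_integral_swap hfi
  have hleft : ∫ u : ℝ, ∫ t in Ioi (0 : ℝ), f u t =
      1 / 2 * ∫ u : ℝ, cosTransform g u * Real.log (1 + u ^ 2 / c ^ 2) := by
    rw [← integral_const_mul]
    refine integral_congr_ae (Eventually.of_forall fun u => ?_)
    simp only [hf]
    rw [integral_const_mul, integral_one_sub_cos_mul_exp_div hc]
    ring
  -- The inner integral is inversion at `0` minus inversion at `t`.
  have hright : ∫ t in Ioi (0 : ℝ), ∫ u : ℝ, f u t =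
      Real.pi * ∫ t in Ioi (0 : ℝ), (g 0 - g t) * Real.exp (-(c * t)) / t := by
    rw [← integral_const_mul]
    refine setIntegral_congr_fun measurableSet_Ioi fun t ht => ?_
    have h0 := integral_cosTransform_mul_cos hg hgi hR le_rfl
    have ht1 := integral_cosTransform_mul_cos hg hgi hR (le_of_lt ht)
    simp only [mul_zero, Real.cos_zero, mul_one] at h0
    have hci : Integrable fun u => cosTransform g u * Real.cos (u * t) :=
      hR.mul_bdd (c := 1) (by fun_prop) (Eventually.of_forall fun t => Real.abs_cos_le_one _)
    have h1 : ∀ u, f u t = (cosTransform g u - cosTransform g u * Real.cos (u * t)) *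
        (Real.exp (-(c * t)) / t) := fun u => by
      simp only [hf]; ring
    simp_rw [h1]
    rw [integral_mul_const, integral_sub hR hci, h0, ht1]
    ring
  rw [hleft, hright] at hswap
  linarith

/-! ### The cosine transform of the rising series and the unified identity. -/

/-- The function whose half-line cosine transform is the real part of `risingSeries M` on the
vertical line `Re w = a`. -/
noncomputable def lineKernel (M : ℕ) (a t : ℝ) : ℝ :=
  toddKernel t ^ (M + 1) * Real.exp (-(a * t)) / (M + 1)

theorem continuous_lineKernel (M : ℕ) (a : ℝ) : Continuous (lineKernel M a) := by
  unfold lineKernel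
  fun_prop

theorem integrableOn_lineKernel (M : ℕ) {a : ℝ} (ha : 0 < a) :
    IntegrableOn (lineKernel M a) (Ioi 0) :=
  (integrableOn_toddKernel_pow_mul_exp (M + 1) ha).div_const _

theorem re_risingSeries_vertical (M : ℕ) {a : ℝ} (ha : 0 < a) (u : ℝ) :
    (risingSeries M ((a : ℂ) + Complex.I * u)).re = cosTransform (lineKernel M a) u := by
  set w : ℂ := (a : ℂ) + Complex.I * u with hw
  have hre : w.re = a := by simp [hw]
  have him : w.im = u := by simp [hw]
  have h1 := integral_toddKernel_pow_mul_cexp M (w := w) (by rw [hre]; exact ha)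
  have hi : IntegrableOn (fun t : ℝ =>
      (toddKernel t : ℂ) ^ (M + 1) * Complex.exp (-(w * t))) (Ioi 0) := by
    refine (integrableOn_toddKernel_pow_mul_exp (M + 1) ha).mono' (by fun_prop) ?_
    filter_upwards [ae_restrict_mem measurableSet_Ioi] with t ht
    have := toddKernel_pos (le_of_lt ht)
    rw [norm_mul, norm_pow, Complex.norm_of_nonneg this.le, Complex.norm_exp]
    simp [hre]
  have h2 := congrArg Complex.re h1
  rw [← RCLike.re_to_complex, ← integral_re hi] at h2
  simp only [RCLike.re_to_complex] at h2
  have h3 : (((M : ℂ) + 1) * risingSeries M w).re = ((M : ℝ) + 1) * (risingSeries M w).re := by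
    rw [show ((M : ℂ) + 1) = ((M + 1 : ℝ) : ℂ) by push_cast; rfl, Complex.re_ofReal_mul]
  have hM : (M : ℝ) + 1 ≠ 0 := by positivity
  rw [h3] at h2
  have h4 : (risingSeries M w).re = ((M : ℝ) + 1)⁻¹ * (((M : ℝ) + 1) * (risingSeries M w).re) := by
    field_simp
  rw [h4, ← h2, cosTransform, ← integral_const_mul]
  refine integral_congr_ae (Eventually.of_forall fun t => ?_)
  have h5 : ((toddKernel t : ℂ) ^ (M + 1) * Complex.exp (-(w * t))).re =
      toddKernel t ^ (M + 1) * (Real.exp (-(a * t)) * Real.cos (u * t)) := by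
    rw [← Complex.ofReal_pow, Complex.re_ofReal_mul, Complex.exp_re]
    simp [hre, him]
  simp only [h5, lineKernel]
  field_simp

theorem re_risingSeries_vertical_eq_sum (M : ℕ) {a : ℝ} (ha : 0 < a) (u : ℝ) :
    (risingSeries M ((a : ℂ) + Complex.I * u)).re =
      ∑ j ∈ Finset.range (M + 1), ∑ m ∈ Finset.Icc j M,
        (-1 : ℝ) ^ (M + j) * (m.choose j) * (stirlingS (M + 1) (m + 1)) *
          (((a : ℂ) + Complex.I * u) ^ (m - j) *
            hurwitzZeta ((M + 2 - j : ℕ) : ℂ) ((a : ℂ) + Complex.I * u)).re := by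
  rw [← sum_hurwitzZeta_eq_risingSeries M (by simpa using ha), Complex.re_sum]
  refine Finset.sum_congr rfl fun j _ => ?_
  rw [Complex.re_sum]
  refine Finset.sum_congr rfl fun m _ => ?_
  rw [show (-1 : ℂ) ^ (M + j) * (m.choose j) * (stirlingS (M + 1) (m + 1)) =
    (((-1 : ℝ) ^ (M + j) * (m.choose j) * (stirlingS (M + 1) (m + 1)) : ℝ) : ℂ) by push_cast; rfl,
    Complex.re_ofReal_mul]

theorem le_two_sub_of_mem {M j m : ℕ} (hm : m ∈ Finset.Icc j M) : m - j + 2 ≤ M + 2 - j := by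
  have := Finset.mem_Icc.1 hm
  omega

theorem continuous_cosTransform_lineKernel (M : ℕ) {a : ℝ} (ha : 0 < a) :
    Continuous (cosTransform (lineKernel M a)) := by
  rw [← funext (re_risingSeries_vertical M ha), funext (re_risingSeries_vertical_eq_sum M ha)]
  refine continuous_finsetSum _ fun j _ => continuous_finsetSum _ fun m hm => ?_
  have h1 := continuous_hurwitzZeta_vertical ha (s := M + 2 - j)
    (by have := le_two_sub_of_mem hm; omega)
  fun_prop

/-- The decay is read off from the finite expansion in zeta values, not from smoothness of the
kernel. -/
theorem abs_cosTransform_lineKernel_le (M : ℕ) {a : ℝ} (ha : 0 < a) :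
    ∃ C : ℝ, ∀ u : ℝ, |cosTransform (lineKernel M a) u| ≤
      C * ‖((a : ℂ) + Complex.I * u)⁻¹‖ ^ 2 := by
  have hC : ∀ j m : ℕ, ∃ C : ℝ, m ∈ Finset.Icc j M → ∀ w : ℂ, w.re = a →
      |(w ^ (m - j) * hurwitzZeta ((M + 2 - j : ℕ) : ℂ) w).re| ≤ C * ‖w⁻¹‖ ^ 2 := by
    intro j m
    by_cases hm : m ∈ Finset.Icc j M
    · obtain ⟨C, hC⟩ := abs_re_pow_mul_hurwitzZeta_le ha (le_two_sub_of_mem hm)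
      exact ⟨C, fun _ => hC⟩
    · exact ⟨0, fun h => absurd h hm⟩
  choose C hC using hC
  refine ⟨∑ j ∈ Finset.range (M + 1), ∑ m ∈ Finset.Icc j M,
    |(-1 : ℝ) ^ (M + j) * (m.choose j) * (stirlingS (M + 1) (m + 1))| * C j m, fun u => ?_⟩
  rw [← re_risingSeries_vertical M ha, re_risingSeries_vertical_eq_sum M ha, Finset.sum_mul]
  refine (Finset.abs_sum_le_sum_abs _ _).trans (Finset.sum_le_sum fun j _ => ?_)
  rw [Finset.sum_mul]
  refine (Finset.abs_sum_le_sum_abs _ _).trans (Finset.sum_le_sum fun m hm => ?_)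
  rw [abs_mul]
  refine le_trans ?_ (mul_assoc _ _ _).symm.le
  exact mul_le_mul_of_nonneg_left (hC j m hm ((a : ℂ) + Complex.I * u) (by simp))
    (abs_nonneg _)

theorem integrable_cosTransform_lineKernel (M : ℕ) {a : ℝ} (ha : 0 < a) :
    Integrable (cosTransform (lineKernel M a)) := by
  obtain ⟨C, hC⟩ := abs_cosTransform_lineKernel_le M ha
  exact integrable_of_abs_le_mul_inv_sq (continuous_cosTransform_lineKernel M ha) ha hC

/-- Up to `1/(M+1)`, the integrand is the Gauss integrand of order `M + 1` at `a + c` minus that of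
order `0` at `c`; the `e^{-t}` terms cancel, and order `0` integrates to `log c`. -/
theorem integral_lineKernel (M : ℕ) {a c : ℝ} (ha : 0 < a) (hc : 0 < c) :
    ∫ t in Ioi (0 : ℝ), (lineKernel M a 0 - lineKernel M a t) * Real.exp (-(c * t)) / t =
      1 / (M + 1) * (gaussIntegral (M + 1) (a + c) - Real.log c) := by
  rw [← gaussIntegral_zero hc, gaussIntegral, gaussIntegral,
    ← integral_sub (integrableOn_gaussIntegrand _ (by positivity))
      (integrableOn_gaussIntegrand _ hc), ← integral_const_mul]
  refine integral_congr_ae (Eventually.of_forall fun t => ?_)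
  have h : Real.exp (-((a + c) * t)) = Real.exp (-(a * t)) * Real.exp (-(c * t)) := by
    rw [← Real.exp_add]; ring_nf
  simp only [lineKernel, gaussIntegrand, h, toddKernel_zero]
  simp only [one_pow, mul_zero, neg_zero, Real.exp_zero, pow_zero, one_mul]
  ring

theorem integrableOn_integrand_natCast {a c : ℝ} (ha : 0 < a) (hc : 0 < c) {M j m : ℕ}
    (hm : m ∈ Finset.Icc j M) :
    IntegrableOn (integrand a (m - j) ((M + 2 - j : ℕ) : ℂ) c) (Ioi 0) :=
  (integrable_integrand ha hc (le_two_sub_of_mem hm)).integrableOn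

theorem sum_integral_integrand (M : ℕ) {a c : ℝ} (ha : 0 < a) (hc : 0 < c) :
    ∑ j ∈ Finset.range (M + 1), (-1 : ℝ) ^ (M + j) * ∑ m ∈ Finset.Icc j M,
      (m.choose j : ℝ) * (stirlingS (M + 1) (m + 1) : ℝ) *
        (2 * ∫ u in Ioi (0 : ℝ), integrand a (m - j) ((M + 2 - j : ℕ) : ℂ) c u) =
      -(2 * Real.pi / (M + 1)) * (Real.log c - gaussIntegral (M + 1) (a + c)) := by
  have hR := integrable_cosTransform_lineKernel M ha
  have hRc := continuous_cosTransform_lineKernel M ha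
  obtain ⟨C, hC⟩ := abs_cosTransform_lineKernel_le M ha
  have hRlog := integrable_of_abs_le_inv_sq hRc ha hc hC
  have hmain := integral_cosTransform_mul_log (continuous_lineKernel M a)
    (integrableOn_lineKernel M ha) hRc hR hc hRlog
  rw [integral_lineKernel M ha hc] at hmain
  have heven : ∫ u : ℝ, cosTransform (lineKernel M a) u * Real.log (1 + u ^ 2 / c ^ 2) =
      2 * ∫ u in Ioi (0 : ℝ), cosTransform (lineKernel M a) u *
        Real.log (1 + u ^ 2 / c ^ 2) := by
    rw [← integral_comp_abs (f := fun u => cosTransform (lineKernel M a) u *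
      Real.log (1 + u ^ 2 / c ^ 2))]
    refine integral_congr_ae (Eventually.of_forall fun u => ?_)
    simp only [sq_abs]
    rcases abs_choice u with h | h
    · rw [h]
    · rw [h, cosTransform_neg]
  have hsum : ∫ u in Ioi (0 : ℝ), cosTransform (lineKernel M a) u *
      Real.log (1 + u ^ 2 / c ^ 2) =
      ∑ j ∈ Finset.range (M + 1), ∑ m ∈ Finset.Icc j M,
        (-1 : ℝ) ^ (M + j) * (m.choose j) * (stirlingS (M + 1) (m + 1)) *
          ∫ u in Ioi (0 : ℝ), integrand a (m - j) ((M + 2 - j : ℕ) : ℂ) c u := by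
    simp_rw [← integral_const_mul]
    have hi : ∀ j ∈ Finset.range (M + 1), ∀ m ∈ Finset.Icc j M, Integrable (fun u =>
        (-1 : ℝ) ^ (M + j) * (m.choose j) * (stirlingS (M + 1) (m + 1)) *
          integrand a (m - j) ((M + 2 - j : ℕ) : ℂ) c u) (volume.restrict (Ioi 0)) :=
      fun j _ m hm => (integrableOn_integrand_natCast ha hc hm).const_mul _
    have hj : ∀ j ∈ Finset.range (M + 1),
        ∑ m ∈ Finset.Icc j M, ∫ u in Ioi (0 : ℝ),
          (-1 : ℝ) ^ (M + j) * (m.choose j) * (stirlingS (M + 1) (m + 1)) *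
            integrand a (m - j) ((M + 2 - j : ℕ) : ℂ) c u =
        ∫ u in Ioi (0 : ℝ), ∑ m ∈ Finset.Icc j M,
          (-1 : ℝ) ^ (M + j) * (m.choose j) * (stirlingS (M + 1) (m + 1)) *
            integrand a (m - j) ((M + 2 - j : ℕ) : ℂ) c u :=
      fun j hj => (integral_finsetSum _ (hi j hj)).symm
    rw [Finset.sum_congr rfl hj,
      ← integral_finsetSum _ fun j hj => integrable_finsetSum _ (hi j hj)]
    refine integral_congr_ae (Eventually.of_forall fun u => ?_)
    simp only
    rw [← re_risingSeries_vertical M ha, re_risingSeries_vertical_eq_sum M ha, Finset.sum_mul]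
    refine Finset.sum_congr rfl fun j _ => ?_
    rw [Finset.sum_mul]
    refine Finset.sum_congr rfl fun m _ => ?_
    rw [integrand]
    ring
  have hlhs : ∑ j ∈ Finset.range (M + 1), (-1 : ℝ) ^ (M + j) * ∑ m ∈ Finset.Icc j M,
      (m.choose j : ℝ) * (stirlingS (M + 1) (m + 1) : ℝ) *
        (2 * ∫ u in Ioi (0 : ℝ), integrand a (m - j) ((M + 2 - j : ℕ) : ℂ) c u) =
      2 * ∑ j ∈ Finset.range (M + 1), ∑ m ∈ Finset.Icc j M,
        (-1 : ℝ) ^ (M + j) * (m.choose j) * (stirlingS (M + 1) (m + 1)) *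
          ∫ u in Ioi (0 : ℝ), integrand a (m - j) ((M + 2 - j : ℕ) : ℂ) c u := by
    rw [Finset.mul_sum]
    refine Finset.sum_congr rfl fun j _ => ?_
    rw [Finset.mul_sum, Finset.mul_sum]
    exact Finset.sum_congr rfl fun m _ => by ring
  rw [hlhs, ← hsum, ← heven, hmain]
  ring

/-- The common form of both parts, with `M + 1 = 2ℓ` or `M + 1 = 2ℓ + 1`. -/
theorem sum_integral_integrand_eq_iteratedDeriv (M l : ℕ) (hl : l ≤ M) {a x : ℝ} (ha : 0 < a)
    (hla : (l : ℝ) ≤ a) (hx : a < x) :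
    ∑ j ∈ Finset.range (M + 1), (-1 : ℝ) ^ (M + j) * ∑ m ∈ Finset.Icc j M,
      (m.choose j : ℝ) * (stirlingS (M + 1) (m + 1) : ℝ) *
        (2 * ∫ u in Ioi (0 : ℝ), integrand a (m - j) ((M + 2 - j : ℕ) : ℂ) (x - a) u) =
      -(2 * Real.pi / (M + 1)) * (Real.log (x - a) + (harmonic M : ℝ) -
        iteratedDeriv M (fun t => binom (t - 1) M * digamma (t - l)) x) := by
  -- With `c = x - a` the Gauss integral sits at `a + c = x`, and the harmonic number cancels the
  -- one in the derivative formula.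
  rw [sum_integral_integrand M ha (sub_pos.2 hx),
    iteratedDeriv_binom_mul_digamma_sub hl (hla.trans_lt hx),
    iteratedDeriv_binom_mul_digamma M (ha.trans hx)]
  ring_nf

theorem natCast_add_two_sub {M j : ℕ} (hj : j ≤ M) :
    ((M + 2 - j : ℕ) : ℂ) = (M : ℂ) + 2 - j := by
  rw [Nat.cast_sub (by omega)]
  push_cast
  rfl

end HurwitzLog

/-! ### Specialisation to the two parities. -/

theorem mainTheorem8 :
    (∀ (ℓ : ℕ) (x : ℝ), 1 ≤ ℓ → (ℓ : ℝ) < x →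
      (∀ j ∈ Finset.Icc 0 (2 * ℓ - 1), ∀ m ∈ Finset.Icc j (2 * ℓ - 1),
        MeasureTheory.IntegrableOn (fun u : ℝ => HurwitzLog.zIntegrand ℓ m j x u)
          (Set.Ioi 0)) ∧
      ∑ j ∈ Finset.Icc 0 (2 * ℓ - 1), (-1 : ℝ) ^ ((j : ℤ) - 1) *
          ∑ m ∈ Finset.Icc j (2 * ℓ - 1),
            (m.choose j : ℝ) * (HurwitzLog.stirlingS (2 * ℓ) (m + 1) : ℝ) *
              HurwitzLog.z ℓ m j x =
        -(Real.pi / ℓ) *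
          (Real.log (x - ℓ) + (harmonic (2 * ℓ - 1) : ℝ) -
            iteratedDeriv (2 * ℓ - 1)
              (fun t : ℝ => HurwitzLog.binom (t - 1) (2 * ℓ - 1) * HurwitzLog.digamma (t - ℓ))
              x)) ∧
    (∀ (ℓ : ℕ) (x : ℝ), (ℓ : ℝ) + 1 / 2 < x →
      (∀ j ∈ Finset.Icc 0 (2 * ℓ), ∀ m ∈ Finset.Icc j (2 * ℓ),
        MeasureTheory.IntegrableOn (fun u : ℝ => HurwitzLog.ZIntegrand ℓ m j x u)
          (Set.Ioi 0)) ∧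
      ∑ j ∈ Finset.Icc 0 (2 * ℓ), (-1 : ℝ) ^ j *
          ∑ m ∈ Finset.Icc j (2 * ℓ),
            (m.choose j : ℝ) * (HurwitzLog.stirlingS (2 * ℓ + 1) (m + 1) : ℝ) *
              HurwitzLog.Z ℓ m j x =
        -(2 * Real.pi / (2 * ℓ + 1)) *
          (Real.log (x - ℓ - 1 / 2) + (harmonic (2 * ℓ) : ℝ) -
            iteratedDeriv (2 * ℓ)
              (fun t : ℝ => HurwitzLog.binom (t - 1) (2 * ℓ) * HurwitzLog.digamma (t - ℓ))
              x)) := by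
  constructor
  · intro ℓ x hℓ hx
    -- Part (a) is `M = 2ℓ - 1`, `a = ℓ`; `ℓ ≥ 1` gives both `a > 0` and `ℓ ≤ M`.
    obtain ⟨M, hM⟩ : ∃ M, 2 * ℓ = M + 1 := ⟨2 * ℓ - 1, by omega⟩
    have hM1 : 2 * ℓ - 1 = M := by omega
    have hMr : (M : ℝ) + 1 = 2 * ℓ := by exact_mod_cast hM.symm
    have hMc : (M : ℂ) + 1 = 2 * ℓ := by exact_mod_cast hM.symm
    have ha : (0 : ℝ) < ℓ := by exact_mod_cast hℓ
    have hz : ∀ m j, j ≤ M → HurwitzLog.zIntegrand ℓ m j x =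
        HurwitzLog.integrand ℓ (m - j) ((M + 2 - j : ℕ) : ℂ) (x - ℓ) := by
      intro m j hj
      funext u
      rw [HurwitzLog.zIntegrand, HurwitzLog.natCast_add_two_sub hj,
        show (M : ℂ) + 2 - j = 2 * ℓ + 1 - j by linear_combination hMc]
    rw [hM1, hM]
    refine ⟨fun j hj m hm => ?_, ?_⟩
    · have := HurwitzLog.integrableOn_integrand_natCast ha (sub_pos.2 hx) hm
      rwa [← hz m j (Finset.mem_Icc.1 hj).2] at this
    · have h := HurwitzLog.sum_integral_integrand_eq_iteratedDeriv M ℓ (by omega) ha le_rfl hx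
      rw [hMr, mul_div_mul_left _ _ two_ne_zero] at h
      rw [← h, Nat.range_succ_eq_Icc_zero]
      refine Finset.sum_congr rfl fun j hj => ?_
      -- The integer exponent covers `j = 0`; it differs from `M + j` by the even number `2ℓ`.
      have hsign : (-1 : ℝ) ^ ((j : ℤ) - 1) = (-1) ^ (M + j) := by
        have h1 : ((M + j : ℕ) : ℤ) = ((j : ℤ) - 1) + 2 * ℓ := by push_cast; omega
        rw [← zpow_natCast, h1, zpow_add₀ (by norm_num), zpow_mul]
        simp
      rw [hsign]
      simp only [HurwitzLog.z, hz _ j (Finset.mem_Icc.1 hj).2]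
  · intro ℓ x hx
    -- Part (b) is `M = 2ℓ`, `a = ℓ + 1/2`, still with digamma shift `ℓ`; the case `ℓ = 0` is
    -- included since then `a = 1/2 > 0`.
    have ha : (0 : ℝ) < ℓ + 1 / 2 := by positivity
    have hz : ∀ m j, j ≤ 2 * ℓ → HurwitzLog.ZIntegrand ℓ m j x =
        HurwitzLog.integrand (ℓ + 1 / 2) (m - j) ((2 * ℓ + 2 - j : ℕ) : ℂ)
          (x - (ℓ + 1 / 2)) := by
      intro m j hj
      funext u
      rw [HurwitzLog.ZIntegrand, HurwitzLog.natCast_add_two_sub hj, sub_sub]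
      push_cast
      rfl
    refine ⟨fun j hj m hm => ?_, ?_⟩
    · have := HurwitzLog.integrableOn_integrand_natCast ha (sub_pos.2 hx) hm
      rwa [← hz m j (Finset.mem_Icc.1 hj).2] at this
    · have h := HurwitzLog.sum_integral_integrand_eq_iteratedDeriv (2 * ℓ) ℓ (by omega) ha
        (by linarith) hx
      push_cast at h
      rw [sub_sub, ← h, Nat.range_succ_eq_Icc_zero]
      refine Finset.sum_congr rfl fun j hj => ?_
      have hsign : (-1 : ℝ) ^ (2 * ℓ + j) = (-1) ^ j := by
        rw [pow_add, pow_mul]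
        simp
      rw [hsign]
      simp only [HurwitzLog.Z, hz _ j (Finset.mem_Icc.1 hj).2]
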